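/- Let $d\in\mathbb N$, $Y=[0,2\pi)^d$, and let $A=(a_{jk})$ be a real, symmetric, bounded, measurable, $2\pi\mathbb Z^d$-periodic $d\times d$ matrix field on $\mathbb R^d$ which is elliptic: there is $\alpha>0$ with $A(y)\xi\cdot\xi\ge\alpha|\xi|^2$ for all $\xi\in\mathbb R^d$ and a.e. $y$. For $\rho>0$ and $\eta\in\mathbb R^d$ consider the Bloch eigenvalue problem for $Y$-periodic functions $\phi\in H^2_\sharp(Y)$, $\phi\ne0$, $$\rho^2(\nabla+i\eta)^4\phi-(\nabla+i\eta)\cdot A(y)(\nabla+i\eta)\phi=\lambda\phi ,$$ understood in the weak sense: for all $v\in H^2_\sharp(Y)$, $$\int_Y A(\nabla+i\eta)\phi\cdot\overline{(\nabla+i\eta)v}\,dy+\rho^2\int_Y(\nabla+i\eta)^2\phi\,\overline{(\nabla+i\eta)^2v}\,dy=\lambda\int_Y\phi\,\overline v\,dy .$$ Let $\lambda_1^\rho(\eta)$ be the smallest eigenvalue, and call an eigenfunction $\phi$ for $\lambda_1^\rho(\eta)$ normalized if $\frac1{|Y|}\int_Y\phi\,dy=(2\pi)^{-d/2}$. There is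 $\delta_0>0$, depending on $A$ but not on $\rho$, such that for all $\rho>0$ and $|\eta|<\delta_0$ the eigenvalue $\lambda_1^\rho(\eta)$ exists and is simple and has a (unique) normalized eigenfunction. Moreover, let $\delta>0$ and $U=\{\eta:|\eta|<\delta\}$, and suppose that for all $\rho>0$ and $\eta\in U$ a normalized eigenfunction $\phi_1^\rho(\cdot;\eta)$ for $\lambda_1^\rho(\eta)$ is given. For $\kappa,\epsilon>0$ put $\phi_1^{\kappa,\epsilon}(x;\xi)=\phi_1^{\kappa/\epsilon}(x/\epsilon;\epsilon\xi)$ and, for compactly supported $g\in L^2(\mathbb R^d)$ and $\xi\in\epsilon^{-1}U$, $$\mathcal B_1^{\kappa,\epsilon}g(\xi)=\int_{\mathbb R^d}g(x)e^{-ix\cdot\xi}\,\overline{\phi_1^{\kappa,\epsilon}(x;\xi)}\,dx .$$ Let $\epsilon_n>0$ with $\epsilon_n\to0$, and let $\kappa_n>0$ be arbitrary (so every regime $\kappa_n/\epsilon_n\to\theta\in[0,\infty]$ is covered). Let $K\subset\mathbb R^d$ be compact, and let $g_n\in L^2(\mathbb R^d)$ vanish a.e. outside $K$ and converge weakly in $L^2(\mathbb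 R^d)$ to $g\in L^2(\mathbb R^d)$. Then $$\mathbb 1_{\epsilon_n^{-1}U}\,\mathcal B_1^{\kappa_n,\epsilon_n}g_n\rightharpoonup\widehat g\quad\text{weakly in }L^2_{\mathrm{loc}}(\mathbb R^d),\qquad \widehat g(\xi)=(2\pi)^{-d/2}\int_{\mathbb R^d}g(x)e^{-ix\cdot\xi}\,dx .$$ That is, for every compact $Q\subset\mathbb R^d$, $\widehat g$ and, for all sufficiently large $n$, $\mathbb 1_{\epsilon_n^{-1}U}\mathcal B_1^{\kappa_n,\epsilon_n}g_n$ belong to $L^2(Q)$, and the convergence is weak in $L^2(Q)$. If $\delta\le\delta_0$, then $\mathbb 1_{\epsilon_n^{-1}U}\mathcal B_1^{\kappa_n,\epsilon_n}g_n\in L^2_{\mathrm{loc}}(\mathbb R^d)$ for every $n$. -/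

import Mathlib

open MeasureTheory Filter Topology
open scoped Pointwise ComplexConjugate

noncomputable section

namespace BlochHomogenization

/-- Euclidean space `ℝ^d`. -/
abbrev Space (d : ℕ) : Type := EuclideanSpace ℝ (Fin d)

/-- The periodicity cell `Y = [0, 2π)^d`. -/
def cell (d : ℕ) : Set (Space d) := {y | ∀ j, y j ∈ Set.Ico (0 : ℝ) (2 * Real.pi)}

/-- The lattice vector `2πp`, `p ∈ ℤ^d`. -/
def latticeVec {d : ℕ} (p : Fin d → ℤ) : Space d :=
  WithLp.toLp 2 fun j => 2 * Real.pi * (p j : ℝ)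

/-- `Y`-periodicity (up to null sets, as for all objects below). -/
def IsPeriodic {d : ℕ} {β : Type*} (u : Space d → β) : Prop :=
  ∀ p : Fin d → ℤ, ∀ᵐ y : Space d, u (y + latticeVec p) = u y

/-- The standing assumptions on the coefficients: real, measurable, bounded, elliptic,
`Y`-periodic and symmetric. -/
structure IsAdmissible {d : ℕ} (A : Space d → Matrix (Fin d) (Fin d) ℝ) : Prop where
  measurable : ∀ j k, Measurable fun y => A y j k
  bounded : ∃ M : ℝ, ∀ᵐ y : Space d, ∀ j k, |A y j k| ≤ M
  elliptic : ∃ α : ℝ, 0 < α ∧ ∀ᵐ y : Space d, ∀ ξ : Space d,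
    α * ‖ξ‖ ^ 2 ≤ ∑ j, ∑ k, A y j k * ξ k * ξ j
  periodic : IsPeriodic A
  symmetric : ∀ᵐ y : Space d, (A y).IsSymm

/-- `u ∈ L²_♯(Y)`. -/
def MemL2per {d : ℕ} (u : Space d → ℂ) : Prop :=
  IsPeriodic u ∧ MemLp u 2 (volume.restrict (cell d))

/-- The Fourier coefficient `û(n) = |Y|⁻¹ ∫_Y u(y) e^{-i n·y} dy`, `n ∈ ℤ^d`. -/
def fourierCoeffPer {d : ℕ} (u : Space d → ℂ) (n : Fin d → ℤ) : ℂ :=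
  ⨍ y in cell d, u y * Complex.exp (-Complex.I * ((∑ j, (n j : ℝ) * y j : ℝ) : ℂ))

/-- `u ∈ H²_♯(Y)`: `u` is periodic and `∑ (1 + |n|²)² |û(n)|² < ∞`. -/
def MemH2per {d : ℕ} (u : Space d → ℂ) : Prop :=
  MemL2per u ∧
    Summable fun n : Fin d → ℤ => (1 + ∑ j, (n j : ℝ) ^ 2) ^ 2 * ‖fourierCoeffPer u n‖ ^ 2

/-- `w ∈ L²_♯(Y)` is the distributional derivative `∂_j u` of the periodic function `u`. -/
def IsPerDeriv {d : ℕ} (j : Fin d) (u w : Space d → ℂ) : Prop :=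
  MemL2per w ∧ ∀ n : Fin d → ℤ, fourierCoeffPer w n = Complex.I * (n j : ℂ) * fourierCoeffPer u n

open Classical in
/-- The distributional derivative `∂_j u` of a periodic function, when it lies in `L²_♯(Y)`
(it is then determined almost everywhere); `0` otherwise. -/
def perDeriv {d : ℕ} (j : Fin d) (u : Space d → ℂ) : Space d → ℂ :=
  if h : ∃ w, IsPerDeriv j u w then h.choose else 0

/-- The `j`-th component `(∂_j + iη_j) u` of `(∇ + iη) u`. -/
def shiftedDeriv {d : ℕ} (η : Space d) (j : Fin d) (u : Space d → ℂ) : Space d → ℂ :=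
  fun y => perDeriv j u y + Complex.I * (η j : ℂ) * u y

/-- `(∇ + iη)² u = ∑_j (∂_j + iη_j)² u`. -/
def shiftedLaplacian {d : ℕ} (η : Space d) (u : Space d → ℂ) : Space d → ℂ :=
  fun y => ∑ j, shiftedDeriv η j (shiftedDeriv η j u) y

/-- The sesquilinear form of the shifted operator
`ρ² (∇ + iη)⁴ - (∇ + iη) · A (∇ + iη)` on `H²_♯(Y)`. -/
def blochForm {d : ℕ} (A : Space d → Matrix (Fin d) (Fin d) ℝ) (ρ : ℝ) (η : Space d)
    (u v : Space d → ℂ) : ℂ :=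
  (∫ y in cell d, ∑ j, ∑ k,
      (A y j k : ℂ) * shiftedDeriv η k u y * conj (shiftedDeriv η j v y))
    + (ρ : ℂ) ^ 2 * ∫ y in cell d, shiftedLaplacian η u y * conj (shiftedLaplacian η v y)

/-- `φ ∈ H²_♯(Y)`, `φ ≠ 0`, solves the Bloch eigenvalue problem
`ρ² (∇ + iη)⁴ φ - (∇ + iη) · A (∇ + iη) φ = lam φ`, in the weak sense. -/
def IsBlochEigenpair {d : ℕ} (A : Space d → Matrix (Fin d) (Fin d) ℝ) (ρ : ℝ) (η : Space d)
    (lam : ℝ) (φ : Space d → ℂ) : Prop :=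
  MemH2per φ ∧ ¬ φ =ᵐ[volume] 0 ∧
    ∀ v, MemH2per v → blochForm A ρ η φ v = (lam : ℂ) * ∫ y in cell d, φ y * conj (v y)

/-- `φ` is an eigenfunction for the first (smallest) Bloch eigenvalue `λ₁^ρ(η)`. -/
def IsFirstBlochEigenfunction {d : ℕ} (A : Space d → Matrix (Fin d) (Fin d) ℝ) (ρ : ℝ)
    (η : Space d) (φ : Space d → ℂ) : Prop :=
  ∃ lam : ℝ, IsBlochEigenpair A ρ η lam φ ∧
    ∀ (μ : ℝ) (ψ : Space d → ℂ), IsBlochEigenpair A ρ η μ ψ → lam ≤ μ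

/-- A first Bloch eigenfunction with the normalization `|Y|⁻¹ ∫_Y φ = (2π)^{-d/2}`. -/
def IsNormalizedFirstBloch {d : ℕ} (A : Space d → Matrix (Fin d) (Fin d) ℝ) (ρ : ℝ)
    (η : Space d) (φ : Space d → ℂ) : Prop :=
  IsFirstBlochEigenfunction A ρ η φ ∧
    ⨍ y in cell d, φ y = (((2 * Real.pi) ^ (-(d : ℝ) / 2) : ℝ) : ℂ)

/-- The Bloch eigenfunctions at scale `ε`, `φ^{κ,ε}(x; ξ) = φ^ρ(x/ε; εξ)` with `ρ = κ/ε`;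
the arguments of `φ` are `ρ`, `η`, `y` in this order. -/
def scaledEigenfunction {d : ℕ} (φ : ℝ → Space d → Space d → ℂ) (κ ε : ℝ)
    (ξ x : Space d) : ℂ :=
  φ (κ / ε) (ε • ξ) (ε⁻¹ • x)

/-- The first Bloch transform at scale `ε`,
`B₁^{κ,ε} g(ξ) = ∫ g(x) e^{-i x·ξ} conj (φ₁^{κ,ε}(x; ξ)) dx`. -/
def blochTransform {d : ℕ} (φ : ℝ → Space d → Space d → ℂ) (κ ε : ℝ) (g : Space d → ℂ)
    (ξ : Space d) : ℂ :=
  ∫ x, g x * Complex.exp (-Complex.I * ((inner ℝ x ξ : ℝ) : ℂ)) *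
    conj (scaledEigenfunction φ κ ε ξ x)

/-- The Fourier transform `ĝ(ξ) = (2π)^{-d/2} ∫ g(x) e^{-i x·ξ} dx`. It is used only for `g ∈ L²`
vanishing almost everywhere outside a compact set; such a `g` is integrable. -/
def fourierTransform {d : ℕ} (g : Space d → ℂ) (ξ : Space d) : ℂ :=
  (((2 * Real.pi) ^ (-(d : ℝ) / 2) : ℝ) : ℂ) *
    ∫ x, g x * Complex.exp (-Complex.I * ((inner ℝ x ξ : ℝ) : ℂ))

/-- Weak convergence in `L²(μ)`. -/
def TendstoWeakL2 {d : ℕ} (μ : Measure (Space d)) (F : ℕ → Space d → ℂ) (f : Space d → ℂ) :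
    Prop :=
  (∀ᶠ n in atTop, MemLp (F n) 2 μ) ∧ MemLp f 2 μ ∧
    ∀ ψ : Space d → ℂ, MemLp ψ 2 μ →
      Tendsto (fun n => ∫ x, F n x * conj (ψ x) ∂μ) atTop (𝓝 (∫ x, f x * conj (ψ x) ∂μ))

/-- `f ∈ L²_loc(ℝ^d)`. -/
def MemL2Loc {d : ℕ} (f : Space d → ℂ) : Prop :=
  ∀ Q : Set (Space d), IsCompact Q → MemLp f 2 (volume.restrict Q)

/-- Weak convergence in `L²_loc(ℝ^d)`: weak convergence in `L²(Q)` for every compact `Q`. -/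
def TendstoWeakL2Loc {d : ℕ} (F : ℕ → Space d → ℂ) (f : Space d → ℂ) : Prop :=
  ∀ Q : Set (Space d), IsCompact Q → TendstoWeakL2 (volume.restrict Q) F f

end BlochHomogenization

end

/-! The theorem rests on one estimate: for small `η` the normalized first eigenfunction differs from
the constant `(2π)^{-d/2}` by `O(|η|)` in `L²` of the cell, with a constant independent of `ρ`. At
scale `ε` the quasimomentum is `εξ`, so for bounded `ξ` the Bloch transform differs from the Fourier
transform by `O(ε)`, whatever `κ` is.

Preconditioning by `J = (1 - Δ)⁻¹` (`besselOp`) writes every `u ∈ H²_♯` as `J h` with `h ∈ L²`. The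
weak problem becomes `S h = lam N h` with bounded self-adjoint `S`, `N` and `N = J* J`
(`Represents.isBlochEigenpair_iff`). Put `Λ = ρ²|η|⁴ + K|η|²`, where `K` bounds `A`. The constant
`e` has Rayleigh quotient at most `Λ`. By ellipticity `S` dominates a Fourier multiplier, and a mode
by mode comparison (`symbol_lower`) shows that `S - Λ N` is coercive on `e^⊥`.

This coercivity on a hyperplane replaces compactness. It yields a lowest eigenvalue below `Λ`
(`exists_lowest_eigenvector`), its simplicity (`eq_smul_of_eigen`), a nonzero mean, and, at fixed
`ρ`, Lipschitz dependence of the normalized eigenvector on `S`. Applied to the eigenvector itself,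
the same comparison gives the key estimate (`norm_besselOp_sub_const_le`): the term `ρ²|η|⁴` of `Λ`
cancels against the zero mode, and only `K|η|²` is left to control the other modes.

The integral of `g` against a modulated profile `w(x/ε)` is bounded by `‖g‖` times the norm of `w`
over the cell (`enorm_pairing_le`). With `w` the deviation from the constant, the difference of the
two transforms tends to zero pointwise. The Fourier integrals of `g_n` converge pointwise because
plane waves cut off to `K` are admissible test functions. The transforms are bounded on compact sets
by Banach–Steinhaus, and continuous in `ξ`, hence measurable. Dominated convergence concludes. -/

noncomputable section

namespace BlochHomogenization

/-! ### Lowest eigenvectors of an operator pencil that is coercive on a hyperplane -/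

section AbstractPencil

variable {H : Type*} [NormedAddCommGroup H] [InnerProductSpace ℂ H]

local notation "⟪" x ", " y "⟫" => inner ℂ x y

/-- A nonnegative bounded symmetric operator that is coercive on the orthogonal complement of a
vector and injective is bounded below. -/
theorem exists_kernel_or_coercive [CompleteSpace H] {B : H →L[ℂ] H} (hB : IsSelfAdjoint B)
    (hB0 : ∀ u, 0 ≤ (⟪B u, u⟫).re) {e : H} (he : ‖e‖ = 1) {γ : ℝ} (hγ : 0 < γ)
    (hco : ∀ w, ⟪e, w⟫ = 0 → γ * ‖w‖ ^ 2 ≤ (⟪B w, w⟫).re) :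
    (∃ c, ⟪e, c⟫ = 1 ∧ B c = 0) ∨ ∃ s > 0, ∀ u, s * ‖u‖ ^ 2 ≤ (⟪B u, u⟫).re := by
  have hee : ⟪e, e⟫ = 1 := by simp [inner_self_eq_norm_sq_to_K, he]
  have hsym : ∀ x y, ⟪B x, y⟫ = ⟪x, B y⟫ := fun x y =>
    (ContinuousLinearMap.isSelfAdjoint_iff_isSymmetric.mp hB) x y
  let P : H →L[ℂ] H := ContinuousLinearMap.id ℂ H - (innerSL ℂ e).smulRight e
  have hP : ∀ x, P x = x - ⟪e, x⟫ • e := fun x => by simp [P]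
  have hPe : ∀ x, ⟪e, P x⟫ = 0 := fun x => by simp [hP, he]
  have hPsym : ∀ x y, ⟪P x, y⟫ = ⟪x, P y⟫ := fun x y => by
    simp only [hP, inner_sub_left, inner_sub_right, inner_smul_left, inner_smul_right,
      inner_conj_symm]
    ring
  have hPid : ∀ x, ⟪e, x⟫ = 0 → P x = x := fun x hx => by simp [hP, hx]
  have hpyth : ∀ x, ‖x‖ ^ 2 = ‖⟪e, x⟫‖ ^ 2 + ‖P x‖ ^ 2 := fun x => by
    have h1 : x = ⟪e, x⟫ • e + P x := by simp [hP]
    have h2 : ⟪⟪e, x⟫ • e, P x⟫ = 0 := by rw [inner_smul_left, hPe, mul_zero]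
    have h3 := norm_add_sq_eq_norm_sq_add_norm_sq_of_inner_eq_zero _ _ h2
    rw [← h1, norm_smul, he] at h3
    nlinarith [h3]
  -- `T` is the identity on the line of `e` and the compression of `B` on `e^⊥`; it is coercive with
  -- constant `min 1 γ`, hence invertible.
  let T : H →L[ℂ] H := (innerSL ℂ e).smulRight e + P.comp (B.comp P)
  have hT : ∀ x, T x = ⟪e, x⟫ • e + P (B (P x)) := fun x => by simp [T]
  have hTin : ∀ x, (⟪T x, x⟫).re = ‖⟪e, x⟫‖ ^ 2 + (⟪B (P x), P x⟫).re := fun x => by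
    rw [hT, inner_add_left, inner_smul_left, hPsym, Complex.add_re, mul_comm, Complex.mul_conj,
      Complex.normSq_eq_norm_sq, Complex.ofReal_re]
  have hTu : IsUnit T := by
    refine ContinuousLinearMap.isUnit_of_forall_le_norm_inner_map T
      (c := ⟨min 1 γ, (lt_min one_pos hγ).le⟩) (by exact lt_min one_pos hγ) fun x => ?_
    refine le_trans ?_ (Complex.re_le_norm _)
    rw [hTin, hpyth x]
    have h1 := hco _ (hPe x)
    have h2 : min 1 γ ≤ 1 := min_le_left _ _
    have h3 : min 1 γ ≤ γ := min_le_right _ _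
    change (‖⟪e, x⟫‖ ^ 2 + ‖P x‖ ^ 2) * min 1 γ ≤ _
    nlinarith [sq_nonneg ‖⟪e, x⟫‖, sq_nonneg ‖P x‖]
  -- Schur complement: `w ∈ e^⊥` is chosen so that `c = e + w` is orthogonal to `e^⊥` for the form
  -- of `B`. The form then splits along `c` and `e^⊥`, and the sign of `⟪B c, c⟫` decides between
  -- the two cases.
  obtain ⟨w, hw⟩ : ∃ w, T w = -P (B e) := by
    have := ContinuousLinearMap.isUnit_iff_bijective.mp hTu
    exact this.2 _
  have hwe : ⟪e, w⟫ = 0 := by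
    have h1 : ⟪e, T w⟫ = ⟪e, w⟫ := by simp [hT, he, hPe]
    rw [← h1, hw, inner_neg_right, hPe, neg_zero]
  have hw' : P (B (e + w)) = 0 := by
    have := hw
    rw [hT, hwe, zero_smul, zero_add, hPid w hwe] at this
    rw [map_add, map_add, this, add_neg_cancel]
  set c := e + w with hc
  have hec : ⟪e, c⟫ = 1 := by simp [hc, he, hwe]
  have hBc : B c = ⟪e, B c⟫ • e := by
    have := hP (B c)
    rw [hw'] at this
    exact (sub_eq_zero.mp this.symm)
  have hBcw : ∀ v, ⟪e, v⟫ = 0 → ⟪B c, v⟫ = 0 := fun v hv => by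
    rw [hBc, inner_smul_left, hv, mul_zero]
  by_cases hm : (⟪B c, c⟫).re = 0
  · left
    refine ⟨c, hec, ?_⟩
    have h1 : ⟪B c, c⟫ = conj ⟪e, B c⟫ := by
      conv_lhs => rw [hBc, inner_smul_left, hec, mul_one]
    have h2 : (⟪B c, c⟫).im = 0 := by
      have := inner_conj_symm (𝕜 := ℂ) (B c) c
      rw [← hsym] at this
      exact Complex.conj_eq_iff_im.mp this
    have h3 : ⟪B c, c⟫ = 0 := Complex.ext hm h2
    rw [h3] at h1
    have h4 : ⟪e, B c⟫ = 0 := by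
      rw [← map_eq_zero (starRingEnd ℂ)]; exact h1.symm
    rw [hBc, h4, zero_smul]
  · right
    have hmpos : 0 < (⟪B c, c⟫).re := lt_of_le_of_ne (hB0 c) (Ne.symm hm)
    set m := (⟪B c, c⟫).re
    have hc0 : 0 < ‖c‖ ^ 2 := by
      have : c ≠ 0 := by rintro h; rw [h] at hec; simp at hec
      positivity
    -- For `u = t c + v` the form is at least `m|t|² + γ‖v‖²`, while `‖u‖² ≤ 2|t|²‖c‖² + 2‖v‖²`;
    -- this dictates the constant.
    refine ⟨min (m / (2 * ‖c‖ ^ 2)) (γ / 2), lt_min (by positivity) (by positivity), fun u => ?_⟩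
    set t := ⟪e, u⟫
    set v := u - t • c with hv
    have hev : ⟪e, v⟫ = 0 := by simp [hv, hec, t]
    have hu : u = t • c + v := by simp [hv]
    have hform : (⟪B u, u⟫).re = ‖t‖ ^ 2 * m + (⟪B v, v⟫).re := by
      have h1 : ⟪B u, u⟫ = t * conj t * ⟪B c, c⟫ + ⟪B v, v⟫ := by
        have h2 : ⟪B v, c⟫ = 0 := by
          rw [hsym, ← inner_conj_symm, hBcw v hev, map_zero]
        conv_lhs => rw [hu]
        simp only [map_add, map_smul, inner_add_left, inner_add_right, inner_smul_left,
          inner_smul_right, h2, hBcw v hev]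
        ring
      rw [h1, Complex.mul_conj, Complex.add_re, Complex.re_ofReal_mul, Complex.normSq_eq_norm_sq]
    have hnorm : ‖u‖ ^ 2 ≤ 2 * (‖t‖ ^ 2 * ‖c‖ ^ 2) + 2 * ‖v‖ ^ 2 := by
      have h1 : ‖u‖ ≤ ‖t‖ * ‖c‖ + ‖v‖ := by
        rw [hu, ← norm_smul]; exact norm_add_le _ _
      have h2 : ‖u‖ ^ 2 ≤ (‖t‖ * ‖c‖ + ‖v‖) ^ 2 := by gcongr
      nlinarith [sq_nonneg (‖t‖ * ‖c‖ - ‖v‖)]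
    rw [hform]
    have h1 := hco v hev
    have h2 : min (m / (2 * ‖c‖ ^ 2)) (γ / 2) ≤ m / (2 * ‖c‖ ^ 2) := min_le_left _ _
    have h3 : min (m / (2 * ‖c‖ ^ 2)) (γ / 2) ≤ γ / 2 := min_le_right _ _
    have h4 : 0 < min (m / (2 * ‖c‖ ^ 2)) (γ / 2) := lt_min (by positivity) (by positivity)
    set s := min (m / (2 * ‖c‖ ^ 2)) (γ / 2)
    rw [le_div_iff₀ (by positivity)] at h2
    calc s * ‖u‖ ^ 2 ≤ s * (2 * (‖t‖ ^ 2 * ‖c‖ ^ 2) + 2 * ‖v‖ ^ 2) := by gcongr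
      _ = ‖t‖ ^ 2 * (s * (2 * ‖c‖ ^ 2)) + 2 * s * ‖v‖ ^ 2 := by ring
      _ ≤ ‖t‖ ^ 2 * m + γ * ‖v‖ ^ 2 := by
        gcongr
        linarith
      _ ≤ _ := by gcongr

/-- Existence of a lowest eigenvector for a pencil `S c = lam N c` that is coercive at level `Λ`
off the direction `e`. -/
theorem exists_lowest_eigenvector [CompleteSpace H] {S N : H →L[ℂ] H} (hS : IsSelfAdjoint S)
    (hN : IsSelfAdjoint N) (hS0 : ∀ u, 0 ≤ (⟪S u, u⟫).re) (hN0 : ∀ u, 0 ≤ (⟪N u, u⟫).re)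
    {e : H} (he : ‖e‖ = 1) {γ Λ : ℝ} (hγ : 0 < γ)
    (hco : ∀ w, ⟪e, w⟫ = 0 → γ * ‖w‖ ^ 2 ≤ (⟪S w, w⟫).re - Λ * (⟪N w, w⟫).re)
    (hNe : 0 < (⟪N e, e⟫).re) (hSe : (⟪S e, e⟫).re ≤ Λ * (⟪N e, e⟫).re) :
    ∃ lam : ℝ, lam ≤ Λ ∧ (∀ u, lam * (⟪N u, u⟫).re ≤ (⟪S u, u⟫).re) ∧
      ∃ c, ⟪e, c⟫ = 1 ∧ S c = (lam : ℂ) • N c := by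
  -- The eigenvalue is the largest `l` for which `S - l N` is nonnegative. Testing with `e` bounds
  -- this set by `Λ`, so coercivity on `e^⊥` persists at the supremum.
  set X : Set ℝ := {l | ∀ u, l * (⟪N u, u⟫).re ≤ (⟪S u, u⟫).re} with hX
  have hX0 : (0 : ℝ) ∈ X := fun u => by simpa using hS0 u
  have hXle : ∀ l ∈ X, l ≤ Λ := fun l hl => le_of_mul_le_mul_right ((hl e).trans hSe) hNe
  have hXbdd : BddAbove X := ⟨Λ, hXle⟩
  have hXcl : IsClosed X := by
    simp only [hX, Set.ofPred_forall]
    exact isClosed_iInter fun u => isClosed_le (by fun_prop) continuous_const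
  set lam := sSup X
  have hlamX : lam ∈ X := hXcl.csSup_mem ⟨0, hX0⟩ hXbdd
  have hlamΛ : lam ≤ Λ := hXle _ hlamX
  refine ⟨lam, hlamΛ, hlamX, ?_⟩
  set B : H →L[ℂ] H := S - (lam : ℂ) • N with hBdef
  have hBsa : IsSelfAdjoint B := by
    refine hS.sub ?_
    rw [isSelfAdjoint_iff, star_smul, hN.star_eq]
    simp
  have hBre : ∀ u, (⟪B u, u⟫).re = (⟪S u, u⟫).re - lam * (⟪N u, u⟫).re := fun u => by
    simp [hBdef]
  have hB0 : ∀ u, 0 ≤ (⟪B u, u⟫).re := fun u => by rw [hBre]; linarith [hlamX u]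
  have hBco : ∀ w, ⟪e, w⟫ = 0 → γ * ‖w‖ ^ 2 ≤ (⟪B w, w⟫).re := fun w hw => by
    rw [hBre]
    have := mul_le_mul_of_nonneg_right hlamΛ (hN0 w)
    linarith [hco w hw]
  rcases exists_kernel_or_coercive hBsa hB0 he hγ hBco with ⟨c, hc1, hc2⟩ | ⟨s, hs, hsu⟩
  · exact ⟨c, hc1, sub_eq_zero.mp (by simpa [hBdef] using hc2)⟩
  · exfalso
    -- If `S - lam N` were coercive, `lam` could be increased without losing nonnegativity, since
    -- `N` is bounded. The `+ 1` only keeps the denominator positive.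
    have hmem : lam + s / (‖N‖ + 1) ∈ X := fun u => by
      have h1 := hsu u
      rw [hBre] at h1
      have h2 : (⟪N u, u⟫).re ≤ (‖N‖ + 1) * ‖u‖ ^ 2 := by
        calc (⟪N u, u⟫).re ≤ ‖⟪N u, u⟫‖ := Complex.re_le_norm _
          _ ≤ ‖N u‖ * ‖u‖ := norm_inner_le_norm _ _
          _ ≤ (‖N‖ * ‖u‖) * ‖u‖ := by gcongr; exact N.le_opNorm u
          _ ≤ _ := by nlinarith [sq_nonneg ‖u‖]
      have h3 : s / (‖N‖ + 1) * (⟪N u, u⟫).re ≤ s * ‖u‖ ^ 2 := by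
        have hpos : 0 < ‖N‖ + 1 := by positivity
        calc s / (‖N‖ + 1) * (⟪N u, u⟫).re ≤ s / (‖N‖ + 1) * ((‖N‖ + 1) * ‖u‖ ^ 2) := by gcongr
          _ = _ := by field_simp
      linarith
    have h1 := le_csSup hXbdd hmem
    have h2 : 0 < s / (‖N‖ + 1) := by positivity
    change lam + s / (‖N‖ + 1) ≤ lam at h1
    linarith

/-- A priori bound for normalized lowest eigenvectors. -/
theorem norm_lowest_eigenvector_le {S N : H →L[ℂ] H} {e c : H} (he : ‖e‖ = 1)
    {γ lam : ℝ} (hγ : 0 < γ)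
    (hco : ∀ w, ⟪e, w⟫ = 0 → γ * ‖w‖ ^ 2 ≤ (⟪(S - (lam : ℂ) • N) w, w⟫).re)
    (hec : ⟪e, c⟫ = 1) (hc : S c = (lam : ℂ) • N c) :
    ‖c‖ ≤ 1 + ‖S - (lam : ℂ) • N‖ / γ := by
  set B := S - (lam : ℂ) • N with hB
  set w := c - e with hw
  have hew : ⟪e, w⟫ = 0 := by simp [hw, hec, he]
  have hBc : B c = 0 := by simp [hB, hc]
  -- The deviation `w = c - e` solves an equation with data `-B e` and lies where `B` is coercive.
  have hBw : B w = - B e := by simp [hw, hBc]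
  have h1 : γ * ‖w‖ ^ 2 ≤ ‖B‖ * ‖w‖ := by
    refine (hco w hew).trans ((Complex.re_le_norm _).trans ((norm_inner_le_norm _ _).trans ?_))
    rw [hBw, norm_neg]
    have := B.le_opNorm e
    rw [he, mul_one] at this
    gcongr
  have h2 : ‖w‖ ≤ ‖B‖ / γ := by
    rw [le_div_iff₀ hγ]
    rcases (norm_nonneg w).eq_or_lt with h | h
    · rw [← h]; simp
    · nlinarith
  calc ‖c‖ = ‖e + w‖ := by simp [hw]
    _ ≤ ‖e‖ + ‖w‖ := norm_add_le _ _
    _ ≤ _ := by rw [he]; gcongr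

/-- Lipschitz dependence of the lowest eigenvalue on the operator. -/
theorem lowest_eigenvalue_sub_le {S S' N : H →L[ℂ] H} {c : H} {lam lam' R : ℝ}
    (hmin : ∀ u, lam * (⟪N u, u⟫).re ≤ (⟪S u, u⟫).re) (hc : S' c = (lam' : ℂ) • N c)
    (hNc : 1 ≤ (⟪N c, c⟫).re) (hR : ‖c‖ ≤ R) : lam - lam' ≤ ‖S - S'‖ * R ^ 2 := by
  have h0 : (⟪(S - S') c, c⟫).re = (⟪S c, c⟫).re - lam' * (⟪N c, c⟫).re := by
    simp [hc]
  have h1 : (⟪(S - S') c, c⟫).re ≤ ‖S - S'‖ * R ^ 2 := by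
    calc (⟪(S - S') c, c⟫).re ≤ ‖⟪(S - S') c, c⟫‖ := Complex.re_le_norm _
      _ ≤ ‖(S - S') c‖ * ‖c‖ := norm_inner_le_norm _ _
      _ ≤ (‖S - S'‖ * ‖c‖) * ‖c‖ := by gcongr; exact (S - S').le_opNorm c
      _ = ‖S - S'‖ * ‖c‖ ^ 2 := by ring
      _ ≤ _ := by gcongr
  -- The eigenvector of `S'` serves as trial vector for `S`; `hNc` then allows dividing by its mass.
  have h2 := hmin c
  by_cases h : lam - lam' ≤ 0
  · exact h.trans (by positivity)
  · push Not at h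
    nlinarith

/-- Lipschitz dependence of the normalized lowest eigenvector on the operator. -/
theorem norm_lowest_eigenvector_sub_le {S S' N : H →L[ℂ] H} {e c c' : H} {γ lam lam' R : ℝ}
    (hγ : 0 < γ) (hN0 : ‖N‖ ≤ 1)
    (hco : ∀ w, ⟪e, w⟫ = 0 → γ * ‖w‖ ^ 2 ≤ (⟪(S - (lam : ℂ) • N) w, w⟫).re)
    (hmin : ∀ u, lam * (⟪N u, u⟫).re ≤ (⟪S u, u⟫).re)
    (hmin' : ∀ u, lam' * (⟪N u, u⟫).re ≤ (⟪S' u, u⟫).re)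
    (hec : ⟪e, c⟫ = 1) (hec' : ⟪e, c'⟫ = 1)
    (hc : S c = (lam : ℂ) • N c) (hc' : S' c' = (lam' : ℂ) • N c')
    (hNc : 1 ≤ (⟪N c, c⟫).re) (hNc' : 1 ≤ (⟪N c', c'⟫).re) (hR : ‖c‖ ≤ R) (hR' : ‖c'‖ ≤ R) :
    ‖c - c'‖ ≤ ‖S - S'‖ * ((1 + R ^ 2) * R / γ) := by
  have hlam : |lam - lam'| ≤ ‖S - S'‖ * R ^ 2 := by
    refine abs_sub_le_iff.mpr ⟨lowest_eigenvalue_sub_le hmin hc' hNc' hR', ?_⟩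
    rw [norm_sub_rev]
    exact lowest_eigenvalue_sub_le hmin' hc hNc hR
  set w := c - c' with hw
  have hew : ⟪e, w⟫ = 0 := by simp [hw, hec, hec']
  -- The two eigenvalue equations are subtracted; both terms on the right are of order `‖S - S'‖`,
  -- and `w` has no component along `e`.
  have hBw : (S - (lam : ℂ) • N) w = -((S - S') c' - ((lam - lam' : ℝ) : ℂ) • N c') := by
    have h1 : (S - (lam : ℂ) • N) c = 0 := by simp [hc]
    rw [hw, map_sub, h1]
    simp only [sub_apply, smul_apply, hc',
      Complex.ofReal_sub, sub_smul]
    abel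
  have hbound : ‖(S - (lam : ℂ) • N) w‖ ≤ ‖S - S'‖ * ((1 + R ^ 2) * R) := by
    have hNc' : ‖N c'‖ ≤ R := by
      calc ‖N c'‖ ≤ ‖N‖ * ‖c'‖ := N.le_opNorm _
        _ ≤ 1 * R := by gcongr
        _ = R := one_mul R
    rw [hBw, norm_neg]
    calc _ ≤ ‖(S - S') c'‖ + ‖((lam - lam' : ℝ) : ℂ) • N c'‖ := norm_sub_le _ _
      _ ≤ ‖S - S'‖ * R + (‖S - S'‖ * R ^ 2) * R := by
        rw [norm_smul, Complex.norm_real, Real.norm_eq_abs]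
        gcongr
        exact ((S - S').le_opNorm _).trans (by gcongr)
      _ = _ := by ring
  have h1 : γ * ‖w‖ ^ 2 ≤ (‖S - S'‖ * ((1 + R ^ 2) * R)) * ‖w‖ := by
    refine (hco w hew).trans ((Complex.re_le_norm _).trans ((norm_inner_le_norm _ _).trans ?_))
    gcongr
  rw [← mul_div_assoc, le_div_iff₀ hγ]
  rcases (norm_nonneg w).eq_or_lt with h | h
  · have hR0 : 0 ≤ R := (norm_nonneg c).trans hR
    rw [← h, zero_mul]; positivity
  · nlinarith

end AbstractPencil

/-! ### The Fourier basis on the periodicity cell -/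

section FourierBasis

variable {d : ℕ}

/-- Normalized Lebesgue measure on the periodicity cell. -/
def cellMeasure (d : ℕ) : Measure (Space d) :=
  (volume.restrict (cell d) Set.univ)⁻¹ • volume.restrict (cell d)

theorem cell_eq_preimage :
    cell d = (WithLp.ofLp : Space d → Fin d → ℝ) ⁻¹'
      Set.univ.pi fun _ => Set.Ico (0 : ℝ) (2 * Real.pi) := by
  ext y; simp [cell]

theorem measurableSet_cell : MeasurableSet (cell d) := by
  rw [cell_eq_preimage]
  exact (PiLp.volume_preserving_ofLp (Fin d)).measurable
    (MeasurableSet.univ_pi fun _ => measurableSet_Ico)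

theorem measurePreserving_ofLp_cell :
    MeasurePreserving (WithLp.ofLp : Space d → Fin d → ℝ) (volume.restrict (cell d))
      (Measure.pi fun _ => (volume : Measure ℝ).restrict (Set.Ico 0 (2 * Real.pi))) := by
  rw [cell_eq_preimage, ← Measure.restrict_pi_pi]
  exact (PiLp.volume_preserving_ofLp (Fin d)).restrict_preimage
    (MeasurableSet.univ_pi fun _ => measurableSet_Ico)

theorem volume_cell : volume (cell d) = ENNReal.ofReal (2 * Real.pi) ^ d := by
  have := measurePreserving_ofLp_cell.measure_preimage (μa := volume.restrict (cell d))
    (MeasurableSet.univ.nullMeasurableSet)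
  rw [Set.preimage_univ, Measure.restrict_apply_univ, Measure.pi_univ] at this
  simpa using this

theorem volume_cell_ne_zero : volume (cell d) ≠ 0 := by
  rw [volume_cell]
  exact pow_ne_zero _ (by simpa using Real.pi_pos)

theorem volume_cell_ne_top : volume (cell d) ≠ ⊤ := by
  rw [volume_cell]
  exact ENNReal.pow_ne_top ENNReal.ofReal_ne_top

instance : IsFiniteMeasure ((volume : Measure (Space d)).restrict (cell d)) :=
  ⟨by rw [Measure.restrict_apply_univ]; exact volume_cell_ne_top.lt_top⟩

theorem cellMeasure_eq : cellMeasure d = (volume (cell d))⁻¹ • volume.restrict (cell d) := by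
  rw [cellMeasure, Measure.restrict_apply_univ]

theorem restrict_cell_eq : volume.restrict (cell d) = volume (cell d) • cellMeasure d := by
  rw [cellMeasure_eq, smul_smul, ENNReal.mul_inv_cancel volume_cell_ne_zero volume_cell_ne_top,
    one_smul]

instance : IsProbabilityMeasure (cellMeasure d) :=
  ⟨by
    rw [cellMeasure_eq, Measure.smul_apply, Measure.restrict_apply_univ, smul_eq_mul,
      ENNReal.inv_mul_cancel volume_cell_ne_zero volume_cell_ne_top]⟩

theorem memLp_cellMeasure_iff {u : Space d → ℂ} {p : ENNReal} :
    MemLp u p (cellMeasure d) ↔ MemLp u p (volume.restrict (cell d)) := by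
  constructor
  · intro h; rw [restrict_cell_eq]; exact h.smul_measure volume_cell_ne_top
  · intro h; rw [cellMeasure_eq]
    exact h.smul_measure (ENNReal.inv_ne_top.mpr volume_cell_ne_zero)

theorem ae_cellMeasure_iff {p : Space d → Prop} :
    (∀ᵐ y ∂cellMeasure d, p y) ↔ ∀ᵐ y ∂volume.restrict (cell d), p y := by
  rw [cellMeasure_eq]
  simp only [ae_iff, Measure.smul_apply, smul_eq_mul, mul_eq_zero, ENNReal.inv_eq_zero,
    volume_cell_ne_top, false_or]

theorem integral_cell_eq {E : Type*} [NormedAddCommGroup E] [NormedSpace ℝ E] (f : Space d → E) :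
    ∫ y in cell d, f y = (volume (cell d)).toReal • ∫ y, f y ∂cellMeasure d := by
  rw [restrict_cell_eq, integral_smul_measure]

/-- Normalized Haar measure on the torus. -/
abbrev torusMeasure (d : ℕ) : Measure (UnitAddTorus (Fin d)) :=
  Measure.pi fun _ => AddCircle.haarAddCircle

/-- The quotient map from Euclidean space to the torus that identifies the lattice vectors. -/
def toTorus (y : Space d) : UnitAddTorus (Fin d) :=
  fun j => ((y j / (2 * Real.pi) : ℝ) : UnitAddCircle)

/-- The section of `toTorus` with values in the cell. -/
def torusSection (x : UnitAddTorus (Fin d)) : Space d :=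
  WithLp.toLp 2 fun j => 2 * Real.pi * (AddCircle.equivIco 1 0 (x j) : ℝ)

theorem toTorus_torusSection (x : UnitAddTorus (Fin d)) : toTorus (torusSection x) = x := by
  ext j
  have h : 2 * Real.pi ≠ 0 := by positivity
  simp only [toTorus, torusSection]
  rw [mul_div_cancel_left₀ _ h]
  exact (AddCircle.equivIco (1 : ℝ) 0).symm_apply_apply (x j)

theorem torusSection_toTorus {y : Space d} (hy : y ∈ cell d) : torusSection (toTorus y) = y := by
  ext j
  have h : 0 < 2 * Real.pi := by positivity
  simp only [toTorus, torusSection]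
  rw [AddCircle.coe_equivIco_mk_apply, div_one, mul_one, Int.fract_eq_self.mpr]
  · field_simp
  · exact ⟨div_nonneg (hy j).1 h.le, (div_lt_one h).mpr (hy j).2⟩

theorem measurable_torusSection : Measurable (torusSection (d := d)) := by
  refine (PiLp.volume_preserving_toLp (Fin d)).measurable.comp (measurable_pi_lambda _ fun j => ?_)
  refine Measurable.const_mul ?_ _
  exact measurable_subtype_coe.comp
    ((AddCircle.measurableEquivIco 1 0).measurable.comp (measurable_pi_apply j))

theorem measurePreserving_interval :
    MeasurePreserving (fun t : ℝ => ((t / (2 * Real.pi) : ℝ) : UnitAddCircle))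
      ((volume : Measure ℝ).restrict (Set.Ico 0 (2 * Real.pi)))
      (ENNReal.ofReal (2 * Real.pi) • AddCircle.haarAddCircle) := by
  have h : 0 < 2 * Real.pi := by positivity
  have h1 : MeasurePreserving (fun t : ℝ => t / (2 * Real.pi))
      (volume : Measure ℝ) (ENNReal.ofReal (2 * Real.pi) • volume) := by
    refine ⟨by fun_prop, ?_⟩
    have := Real.map_volume_mul_left (a := (2 * Real.pi)⁻¹) (by positivity)
    rw [inv_inv, abs_of_pos h] at this
    rw [← this]
    congr 1
    ext t
    rw [div_eq_inv_mul]
  have h2 := h1.restrict_preimage (s := Set.Ico 0 1) measurableSet_Ico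
  have h3 : (fun t : ℝ => t / (2 * Real.pi)) ⁻¹' Set.Ico 0 1 = Set.Ico 0 (2 * Real.pi) := by
    ext t
    simp only [Set.mem_preimage, Set.mem_Ico, div_lt_one h, le_div_iff₀ h, zero_mul]
  rw [h3, Measure.restrict_smul] at h2
  have h4 := (UnitAddCircle.measurePreserving_mk 0).smul_measure (ENNReal.ofReal (2 * Real.pi))
  rw [AddCircle.volume_eq_smul_haarAddCircle, ENNReal.ofReal_one, one_smul, zero_add,
    ← restrict_Ico_eq_restrict_Ioc] at h4
  exact h4.comp h2

theorem measurePreserving_toTorus :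
    MeasurePreserving (toTorus (d := d)) (cellMeasure d) (torusMeasure d) := by
  have : IsFiniteMeasure (ENNReal.ofReal (2 * Real.pi) •
      (AddCircle.haarAddCircle : Measure UnitAddCircle)) :=
    Measure.smul_finite _ ENNReal.ofReal_ne_top
  have h1 := (measurePreserving_pi _ _ fun _ : Fin d => measurePreserving_interval).comp
    measurePreserving_ofLp_cell
  have h2 : Measure.pi (fun _ : Fin d =>
      ENNReal.ofReal (2 * Real.pi) • (AddCircle.haarAddCircle : Measure UnitAddCircle)) =
      volume (cell d) • torusMeasure d := by
    refine Measure.pi_eq fun s _ => ?_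
    rw [Measure.smul_apply, Measure.pi_pi, volume_cell]
    simp [Finset.prod_mul_distrib]
  rw [h2] at h1
  have h3 := h1.smul_measure (volume (cell d))⁻¹
  rw [smul_smul, ENNReal.inv_mul_cancel volume_cell_ne_zero volume_cell_ne_top, one_smul,
    ← cellMeasure_eq] at h3
  exact h3

/-- `torusSection` inverts the measure preserving map `toTorus` almost everywhere on the cell, so it
preserves the measures as well. -/
theorem measurePreserving_torusSection :
    MeasurePreserving (torusSection (d := d)) (torusMeasure d) (cellMeasure d) := by
  refine ⟨measurable_torusSection, ?_⟩
  rw [← measurePreserving_toTorus.map_eq,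
    Measure.map_map measurable_torusSection measurePreserving_toTorus.measurable]
  conv_rhs => rw [← Measure.map_id (μ := cellMeasure d)]
  refine Measure.map_congr ?_
  rw [EventuallyEq, ae_cellMeasure_iff]
  exact (ae_restrict_mem measurableSet_cell).mono fun y hy => torusSection_toTorus hy

/-- `L²` of the cell with normalized Lebesgue measure. -/
abbrev CellL2 (d : ℕ) : Type := Lp ℂ 2 (cellMeasure d)

/-- The isometric identification of `L²` of the cell with `L²` of the torus. -/
def cellL2EquivTorus (d : ℕ) : CellL2 d ≃ₗᵢ[ℂ] Lp ℂ 2 (torusMeasure d) :=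
  LinearIsometryEquiv.ofSurjective
    (Lp.compMeasurePreservingₗᵢ ℂ torusSection measurePreserving_torusSection) fun F => by
      refine ⟨Lp.compMeasurePreserving toTorus measurePreserving_toTorus F, ?_⟩
      change Lp.compMeasurePreserving torusSection measurePreserving_torusSection _ = F
      refine Lp.ext ((Lp.coeFn_compMeasurePreserving _ _).trans ?_)
      refine (measurePreserving_torusSection.quasiMeasurePreserving.ae_eq_comp
        (Lp.coeFn_compMeasurePreserving _ _)).trans ?_
      exact Eventually.of_forall fun x => by simp [toTorus_torusSection]

/-- The Fourier basis of `L²` of the cell. -/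
def fourierBasis (d : ℕ) : HilbertBasis (Fin d → ℤ) ℂ (CellL2 d) :=
  HilbertBasis.ofRepr ((cellL2EquivTorus d).trans UnitAddTorus.mFourierBasis.repr)

theorem mFourier_toTorus (n : Fin d → ℤ) (y : Space d) :
    UnitAddTorus.mFourier (-n) (toTorus y) =
      Complex.exp (-Complex.I * ((∑ j, (n j : ℝ) * y j : ℝ) : ℂ)) := by
  simp only [UnitAddTorus.mFourier, toTorus, ContinuousMap.coe_mk, fourier_coe_apply]
  rw [← Complex.exp_sum]
  congr 1
  push_cast
  rw [Finset.mul_sum]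
  refine Finset.sum_congr rfl fun j _ => ?_
  have : (Real.pi : ℂ) ≠ 0 := by exact_mod_cast Real.pi_ne_zero
  simp only [Pi.neg_apply, Int.cast_neg]
  field_simp

/-- This links the abstract basis to the integrals in the definition of `H²_♯`: the coefficient
formula on the torus is carried back to the cell by `torusSection`. -/
theorem fourierBasis_repr {u : Space d → ℂ} (hu : MemLp u 2 (cellMeasure d)) (n : Fin d → ℤ) :
    (fourierBasis d).repr (hu.toLp u) n = fourierCoeffPer u n := by
  change UnitAddTorus.mFourierBasis.repr (cellL2EquivTorus d (hu.toLp u)) n = _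
  rw [UnitAddTorus.mFourierBasis_repr]
  have h1 : cellL2EquivTorus d (hu.toLp u) =
      (hu.comp_measurePreserving measurePreserving_torusSection).toLp (u ∘ torusSection) :=
    Lp.toLp_compMeasurePreserving hu measurePreserving_torusSection
  rw [h1, UnitAddTorus.mFourierCoeff]
  change ∫ t, _ ∂torusMeasure d = _
  rw [integral_congr_ae (g := fun t => (UnitAddTorus.mFourier (-n) (toTorus (torusSection t))) •
      u (torusSection t))
    ((hu.comp_measurePreserving measurePreserving_torusSection).coeFn_toLp.mono fun t ht => by
      simp only [ht, toTorus_torusSection, Function.comp_apply])]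
  have hmeas : AEStronglyMeasurable
      (fun y => UnitAddTorus.mFourier (-n) (toTorus y) • u y) (cellMeasure d) := by
    refine AEStronglyMeasurable.fun_smul ?_ hu.1
    exact ((UnitAddTorus.mFourier (-n)).continuous.measurable.comp
      measurePreserving_toTorus.measurable).aestronglyMeasurable
  have h2 := integral_map (μ := torusMeasure d) (φ := torusSection)
    measurable_torusSection.aemeasurable
    (f := fun y => UnitAddTorus.mFourier (-n) (toTorus y) • u y)
    (by rw [measurePreserving_torusSection.map_eq]; exact hmeas)
  rw [← h2, measurePreserving_torusSection.map_eq]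
  -- The average `⨍` unfolds definitionally to an integral against `cellMeasure`, which is why that
  -- measure is written with the mass of the restricted measure.
  change _ = ∫ y, _ ∂cellMeasure d
  simp only [mFourier_toTorus, smul_eq_mul, mul_comm]

end FourierBasis

/-! ### Fourier multipliers -/

section Multiplier

variable {ι H : Type*} [NormedAddCommGroup H] [InnerProductSpace ℂ H]

theorem hasSum_norm_sq_repr (b : HilbertBasis ι ℂ H) (f : H) :
    HasSum (fun i => ‖b.repr f i‖ ^ 2) (‖f‖ ^ 2) := by
  have := lp.hasSum_norm (p := 2) (by norm_num) (b.repr f)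
  simpa [LinearIsometryEquiv.norm_map] using this

/-- An `ℓ²` family is the family of coefficients of a vector. -/
theorem exists_repr_eq (b : HilbertBasis ι ℂ H) {a : ι → ℂ} (ha : Summable fun i => ‖a i‖ ^ 2) :
    ∃ f : H, ∀ i, b.repr f i = a i :=
  ⟨b.repr.symm ⟨a, memℓp_gen (by simpa using ha)⟩, fun i => by simp⟩

theorem memℓp_mul_repr (b : HilbertBasis ι ℂ H) {m : ι → ℂ} (hm : ∀ i, ‖m i‖ ≤ 1) (f : H) :
    Memℓp (fun i => m i * b.repr f i) 2 := by
  refine memℓp_gen ?_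
  simp only [ENNReal.toReal_ofNat, Real.rpow_ofNat]
  refine (hasSum_norm_sq_repr b f).summable.of_nonneg_of_le (fun i => by positivity) fun i => ?_
  rw [norm_mul, mul_pow]
  exact mul_le_of_le_one_left (by positivity) (pow_le_one₀ (norm_nonneg _) (hm i))

/-- The operator that multiplies the coefficients in a Hilbert basis by a family bounded by `1`. -/
def multiplier (b : HilbertBasis ι ℂ H) (m : ι → ℂ) (hm : ∀ i, ‖m i‖ ≤ 1) : H →L[ℂ] H :=
  LinearMap.mkContinuous
    { toFun := fun f => b.repr.symm ⟨fun i => m i * b.repr f i, memℓp_mul_repr b hm f⟩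
      map_add' := fun f g => by
        apply b.repr.injective
        ext i
        simp only [map_add, LinearIsometryEquiv.apply_symm_apply, lp.coeFn_add, Pi.add_apply,
          mul_add]
      map_smul' := fun c f => by
        apply b.repr.injective
        ext i
        simp [mul_left_comm] } 1 fun f => by
    rw [one_mul, ← sq_le_sq₀ (norm_nonneg _) (norm_nonneg _)]
    refine hasSum_le (fun i => ?_) (hasSum_norm_sq_repr b _) (hasSum_norm_sq_repr b f)
    simp only [LinearMap.coe_mk, AddHom.coe_mk, LinearIsometryEquiv.apply_symm_apply]
    rw [norm_mul, mul_pow]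
    exact mul_le_of_le_one_left (by positivity) (pow_le_one₀ (norm_nonneg _) (hm i))

theorem repr_multiplier (b : HilbertBasis ι ℂ H) (m : ι → ℂ) (hm : ∀ i, ‖m i‖ ≤ 1) (f : H)
    (i : ι) : b.repr (multiplier b m hm f) i = m i * b.repr f i := by
  simp [multiplier]

theorem norm_multiplier_le (b : HilbertBasis ι ℂ H) (m : ι → ℂ) (hm : ∀ i, ‖m i‖ ≤ 1) :
    ‖multiplier b m hm‖ ≤ 1 :=
  LinearMap.mkContinuous_norm_le _ zero_le_one _

end Multiplier

/-! ### Periodic functions -/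

section Periodic

variable {d : ℕ}

/-- The translated periodicity cell `Y + 2πp`. -/
def shiftedCell (p : Fin d → ℤ) : Set (Space d) := (fun y => y - latticeVec p) ⁻¹' cell d

theorem mem_shiftedCell_floor (y : Space d) :
    y ∈ shiftedCell fun j => ⌊y j / (2 * Real.pi)⌋ := by
  intro j
  have h : 0 < 2 * Real.pi := by positivity
  have h1 := Int.floor_le (y j / (2 * Real.pi))
  have h2 := Int.lt_floor_add_one (y j / (2 * Real.pi))
  rw [le_div_iff₀ h] at h1
  rw [div_lt_iff₀ h] at h2
  simp only [latticeVec, PiLp.sub_apply, Set.mem_Ico]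
  constructor <;> linarith

theorem iUnion_shiftedCell : ⋃ p : Fin d → ℤ, shiftedCell p = (Set.univ : Set (Space d)) :=
  Set.eq_univ_of_forall fun y => Set.mem_iUnion.mpr ⟨_, mem_shiftedCell_floor y⟩

theorem measurePreserving_sub_latticeVec (p : Fin d → ℤ) :
    MeasurePreserving (fun y : Space d => y - latticeVec p) (volume.restrict (shiftedCell p))
      (volume.restrict (cell d)) :=
  (measurePreserving_sub_right volume (latticeVec p)).restrict_preimage measurableSet_cell

theorem IsPeriodic.sub_latticeVec {β : Type*} {u : Space d → β} (hu : IsPeriodic u)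
    (p : Fin d → ℤ) : ∀ᵐ y : Space d, u (y - latticeVec p) = u y := by
  have := (measurePreserving_sub_right volume (latticeVec p)).quasiMeasurePreserving.ae (hu p)
  filter_upwards [this] with y hy
  rw [← hy, sub_add_cancel]

/-- Countably many translates of the cell cover the space, so the exceptional sets still have
measure zero in total. -/
theorem ae_eq_of_ae_eq_cell {β : Type*} {u v : Space d → β} (hu : IsPeriodic u)
    (hv : IsPeriodic v) (h : u =ᵐ[volume.restrict (cell d)] v) : u =ᵐ[volume] v := by
  have key : ∀ p : Fin d → ℤ, u =ᵐ[volume.restrict (shiftedCell p)] v := fun p => by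
    have h1 := (measurePreserving_sub_latticeVec p).quasiMeasurePreserving.ae h
    filter_upwards [h1, ae_restrict_of_ae (hu.sub_latticeVec p),
      ae_restrict_of_ae (hv.sub_latticeVec p)] with y hy hy1 hy2
    rw [← hy1, ← hy2, hy]
  rw [← Measure.restrict_univ (μ := (volume : Measure (Space d))), ← iUnion_shiftedCell,
    EventuallyEq, ae_restrict_iUnion_iff]
  exact key

theorem MemL2per.aestronglyMeasurable {u : Space d → ℂ} (hu : MemL2per u) :
    AEStronglyMeasurable u volume := by
  rw [← Measure.restrict_univ (μ := (volume : Measure (Space d))), ← iUnion_shiftedCell,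
    aestronglyMeasurable_iUnion_iff]
  intro p
  have h1 := hu.2.1.comp_measurePreserving (measurePreserving_sub_latticeVec p)
  exact h1.congr (ae_restrict_of_ae (hu.1.sub_latticeVec p))

theorem setLIntegral_shiftedCell {f : Space d → ENNReal} (hf : IsPeriodic f) (p : Fin d → ℤ) :
    ∫⁻ y in shiftedCell p, f y = ∫⁻ y in cell d, f y := by
  rw [← lintegral_congr_ae (ae_restrict_of_ae (hf.sub_latticeVec p))]
  exact (measurePreserving_sub_latticeVec p).lintegral_comp_emb
    (MeasurableEquiv.subRight (latticeVec p)).measurableEmbedding f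

/-- The cell of a point is indexed by the floors of its coordinates over `2π`. These lie in `[-m,
m)`, so `2m` values per coordinate suffice. -/
theorem closedBall_subset_iUnion_shiftedCell {r : ℝ} {m : ℕ} (hm : r < 2 * Real.pi * m) :
    Metric.closedBall (0 : Space d) r ⊆
      ⋃ p : Fintype.piFinset fun _ : Fin d => Finset.Ico (-m : ℤ) m, shiftedCell p.1 := by
  intro y hy
  refine Set.mem_iUnion.mpr ⟨⟨_, Fintype.mem_piFinset.mpr fun j => ?_⟩, mem_shiftedCell_floor y⟩
  have h : 0 < 2 * Real.pi := by positivity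
  have h1 : |y j| < 2 * Real.pi * m := by
    rw [← Real.norm_eq_abs]
    exact ((PiLp.norm_apply_le y j).trans (by simpa using hy)).trans_lt hm
  rw [abs_lt] at h1
  refine Finset.mem_Ico.mpr ⟨Int.le_floor.mpr ?_, Int.floor_lt.mpr ?_⟩
  · rw [le_div_iff₀ h]
    push_cast
    linarith
  · rw [div_lt_iff₀ h]
    push_cast
    linarith

/-- The integral of a periodic function over a ball, compared with its mean over the cell. -/
theorem setLIntegral_closedBall_scaled_le {f : Space d → ENNReal} (hf : IsPeriodic f) {R ε : ℝ}
    (hR : 0 ≤ R) (hε : 0 < ε) :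
    ∫⁻ x in Metric.closedBall 0 R, f (ε⁻¹ • x) ≤
      ENNReal.ofReal ((2 * R + 4 * Real.pi * ε) ^ d) * ∫⁻ y, f y ∂cellMeasure d := by
  have hpi : 0 < 2 * Real.pi := by positivity
  -- Floor plus one gives the strict inequality needed for covering the ball of radius `R/ε`, and
  -- overshoots by at most one period; hence the total volume `(4πεm)^d ≤ (2R + 4πε)^d` after
  -- rescaling.
  set m : ℕ := ⌊R / (2 * Real.pi * ε)⌋₊ + 1 with hm
  have hm1 : R / ε < 2 * Real.pi * m := by
    have := Nat.lt_floor_add_one (R / (2 * Real.pi * ε))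
    rw [div_lt_iff₀ (by positivity)] at this
    rw [div_lt_iff₀ hε, hm]
    push_cast
    linarith
  have hm2 : (m : ℝ) * (2 * Real.pi * ε) ≤ R + 2 * Real.pi * ε := by
    have := Nat.floor_le (a := R / (2 * Real.pi * ε)) (by positivity)
    rw [le_div_iff₀ (by positivity)] at this
    rw [hm]
    push_cast
    linarith
  have hemb : MeasurableEmbedding (fun x : Space d => ε⁻¹ • x) :=
    (Homeomorph.smulOfNeZero ε⁻¹ (inv_ne_zero hε.ne')).measurableEmbedding
  have h1 : ∫⁻ x in Metric.closedBall 0 R, f (ε⁻¹ • x) =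
      ENNReal.ofReal (ε ^ d) * ∫⁻ y in Metric.closedBall 0 (R / ε), f y := by
    have hpre : (fun x : Space d => ε⁻¹ • x) ⁻¹' Metric.closedBall 0 (R / ε) =
        Metric.closedBall 0 R := by
      ext x
      simp only [Set.mem_preimage, mem_closedBall_zero_iff, norm_smul, norm_inv, Real.norm_eq_abs,
        abs_of_pos hε]
      rw [inv_mul_eq_div, div_le_div_iff_of_pos_right hε]
    have hmap := Measure.map_addHaar_smul (volume : Measure (Space d)) (inv_ne_zero hε.ne')
    rw [inv_pow, inv_inv, abs_of_pos (by positivity), finrank_euclideanSpace_fin] at hmap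
    rw [← hpre, ← hemb.lintegral_map, ← hemb.restrict_map, hmap, Measure.restrict_smul,
      lintegral_smul_measure, smul_eq_mul]
  have h2 : ∫⁻ y in Metric.closedBall 0 (R / ε), f y ≤
      ((2 * m : ℕ) : ENNReal) ^ d * ∫⁻ y in cell d, f y := by
    refine (lintegral_mono_set (closedBall_subset_iUnion_shiftedCell hm1)).trans
      ((lintegral_iUnion_le _ _).trans_eq ?_)
    simp only [setLIntegral_shiftedCell hf, tsum_fintype, Finset.sum_const, Finset.card_univ,
      Fintype.card_coe, Fintype.card_piFinset, Int.card_Ico, Finset.prod_const, Fintype.card_fin,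
      nsmul_eq_mul]
    congr 1
    rw [← Nat.cast_pow]
    congr 2
    omega
  rw [h1, restrict_cell_eq, lintegral_smul_measure, smul_eq_mul, volume_cell] at *
  calc _ ≤ _ := mul_le_mul_right h2 _
    _ = (ENNReal.ofReal (ε ^ d) * (((2 * m : ℕ) : ENNReal) ^ d * ENNReal.ofReal (2 * Real.pi) ^ d))
        * ∫⁻ y, f y ∂cellMeasure d := by simp only [mul_assoc]
    _ ≤ _ := by
      refine mul_le_mul_left ?_ _
      rw [← ENNReal.ofReal_natCast, ← ENNReal.ofReal_pow (by positivity),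
        ← ENNReal.ofReal_pow (by positivity), ← ENNReal.ofReal_mul (by positivity),
        ← ENNReal.ofReal_mul (by positivity), ← mul_pow, ← mul_pow]
      refine ENNReal.ofReal_le_ofReal (pow_le_pow_left₀ (by positivity) ?_ _)
      push_cast
      nlinarith

theorem eLpNorm_closedBall_scaled_le {u : Space d → ℂ} (hu : IsPeriodic u) {R ε : ℝ}
    (hR : 0 ≤ R) (hε : 0 < ε) :
    eLpNorm (fun x => u (ε⁻¹ • x)) 2 (volume.restrict (Metric.closedBall 0 R)) ≤
      ENNReal.ofReal (Real.sqrt ((2 * R + 4 * Real.pi * ε) ^ d)) * eLpNorm u 2 (cellMeasure d) := by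
  have hper : IsPeriodic fun y => ‖u y‖ₑ ^ (2 : ℝ) := fun p => (hu p).mono fun y hy => by
    simp only [hy]
  rw [eLpNorm_eq_lintegral_rpow_enorm_toReal (by norm_num) (by norm_num),
    eLpNorm_eq_lintegral_rpow_enorm_toReal (by norm_num) (by norm_num), ENNReal.toReal_ofNat]
  have h := setLIntegral_closedBall_scaled_le hper hR hε
  have h2 := ENNReal.rpow_le_rpow h (z := 1 / 2) (by norm_num)
  rw [ENNReal.mul_rpow_of_nonneg _ _ (by norm_num),
    ENNReal.ofReal_rpow_of_nonneg (by positivity) (by norm_num), ← Real.sqrt_eq_rpow] at h2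
  exact h2

theorem toTorus_add_latticeVec (y : Space d) (p : Fin d → ℤ) :
    toTorus (y + latticeVec p) = toTorus y := by
  ext j
  have h : 2 * Real.pi ≠ 0 := by positivity
  simp only [toTorus, latticeVec, PiLp.add_apply]
  rw [add_div, mul_div_cancel_left₀ _ h, AddCircle.coe_add]
  have : ((p j : ℝ) : UnitAddCircle) = 0 := by
    rw [AddCircle.coe_eq_zero_iff]
    exact ⟨p j, by simp⟩
  rw [this, add_zero]

/-- Every element of `L²` of the cell is the class of a periodic function. -/
theorem exists_memL2per_toLp_eq (f : CellL2 d) :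
    ∃ u : Space d → ℂ, ∃ hu : MemL2per u, (memLp_cellMeasure_iff.mpr hu.2).toLp u = f := by
  -- A class over the cell is extended periodically by passing to the torus and back; on the cell
  -- nothing changes.
  have h1 : (fun y => f (torusSection (toTorus y))) =ᵐ[cellMeasure d] f := by
    rw [EventuallyEq, ae_cellMeasure_iff]
    exact (ae_restrict_mem measurableSet_cell).mono fun y hy => by
      simp only [torusSection_toTorus hy]
  have h2 : MemLp (fun y => f (torusSection (toTorus y))) 2 (cellMeasure d) :=
    (memLp_congr_ae h1).mpr (Lp.memLp f)
  refine ⟨_, ⟨fun p => Eventually.of_forall fun y => ?_, memLp_cellMeasure_iff.mp h2⟩, ?_⟩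
  · rw [toTorus_add_latticeVec]
  · exact Lp.ext (h2.coeFn_toLp.trans h1)

end Periodic

/-! ### Derivatives of periodic functions -/

section Derivatives

variable {d : ℕ}

theorem MemL2per.memLp {u : Space d → ℂ} (hu : MemL2per u) : MemLp u 2 (cellMeasure d) :=
  memLp_cellMeasure_iff.mpr hu.2

/-- The class of a periodic function in `L²` of the cell. -/
def MemL2per.toLp {u : Space d → ℂ} (hu : MemL2per u) : CellL2 d := hu.memLp.toLp u

theorem MemL2per.repr_toLp {u : Space d → ℂ} (hu : MemL2per u) (n : Fin d → ℤ) :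
    (fourierBasis d).repr hu.toLp n = fourierCoeffPer u n :=
  fourierBasis_repr hu.memLp n

theorem MemL2per.toLp_eq {u : Space d → ℂ} (hu : MemL2per u) {f : CellL2 d}
    (h : ∀ n, fourierCoeffPer u n = (fourierBasis d).repr f n) : hu.toLp = f := by
  refine (fourierBasis d).repr.injective ?_
  ext n
  rw [hu.repr_toLp, h]

theorem MemL2per.coeFn_toLp {u : Space d → ℂ} (hu : MemL2per u) : hu.toLp =ᵐ[cellMeasure d] u :=
  hu.memLp.coeFn_toLp

theorem IsPeriodic.comp {β β' : Type*} {u : Space d → β} (hu : IsPeriodic u) (F : β → β') :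
    IsPeriodic fun y => F (u y) :=
  fun p => (hu p).mono fun y hy => by simp only [hy]

theorem IsPeriodic.comp₂ {β β' β'' : Type*} {u : Space d → β} {v : Space d → β'}
    (hu : IsPeriodic u) (hv : IsPeriodic v) (F : β → β' → β'') :
    IsPeriodic fun y => F (u y) (v y) := fun p => by
  filter_upwards [hu p, hv p] with y hy1 hy2
  rw [hy1, hy2]

theorem MemL2per.add {u v : Space d → ℂ} (hu : MemL2per u) (hv : MemL2per v) :
    MemL2per fun y => u y + v y :=
  ⟨hu.1.comp₂ hv.1 (· + ·), hu.2.add hv.2⟩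

theorem MemL2per.const_mul {u : Space d → ℂ} (hu : MemL2per u) (c : ℂ) :
    MemL2per fun y => c * u y :=
  ⟨hu.1.comp (c * ·), hu.2.const_mul c⟩

theorem memL2per_const (c : ℂ) : MemL2per fun _ : Space d => c :=
  ⟨fun _ => Eventually.of_forall fun _ => rfl, memLp_const c⟩

theorem MemL2per.toLp_add {u v : Space d → ℂ} (hu : MemL2per u) (hv : MemL2per v) :
    (hu.add hv).toLp = hu.toLp + hv.toLp := rfl

theorem MemL2per.toLp_const_mul {u : Space d → ℂ} (hu : MemL2per u) (c : ℂ) :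
    (hu.const_mul c).toLp = c • hu.toLp := rfl

theorem fourierCoeffPer_add {u v : Space d → ℂ} (hu : MemL2per u) (hv : MemL2per v)
    (n : Fin d → ℤ) :
    fourierCoeffPer (fun y => u y + v y) n = fourierCoeffPer u n + fourierCoeffPer v n := by
  rw [← (hu.add hv).repr_toLp, hu.toLp_add hv, map_add, lp.coeFn_add, Pi.add_apply, hu.repr_toLp,
    hv.repr_toLp]

theorem fourierCoeffPer_const_mul {u : Space d → ℂ} (hu : MemL2per u) (c : ℂ) (n : Fin d → ℤ) :
    fourierCoeffPer (fun y => c * u y) n = c * fourierCoeffPer u n := by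
  rw [← (hu.const_mul c).repr_toLp, hu.toLp_const_mul, map_smul, lp.coeFn_smul, Pi.smul_apply,
    hu.repr_toLp, smul_eq_mul]

theorem MemL2per.sum {ι : Type*} {s : Finset ι} {u : ι → Space d → ℂ}
    (hu : ∀ i ∈ s, MemL2per (u i)) : MemL2per (fun y => ∑ i ∈ s, u i y) ∧
      ∀ n, fourierCoeffPer (fun y => ∑ i ∈ s, u i y) n = ∑ i ∈ s, fourierCoeffPer (u i) n := by
  classical
  induction s using Finset.induction_on with
  | empty =>
    simp only [Finset.sum_empty]
    exact ⟨memL2per_const 0, fun n => by simp [fourierCoeffPer]⟩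
  | insert a s ha ih =>
    obtain ⟨h1, h2⟩ := ih fun i hi => hu i (Finset.mem_insert_of_mem hi)
    have h3 := hu a (Finset.mem_insert_self a s)
    simp only [Finset.sum_insert ha]
    exact ⟨h3.add h1, fun n => by rw [fourierCoeffPer_add h3 h1, h2]⟩

theorem exists_memL2per_fourierCoeffPer_eq {a : (Fin d → ℤ) → ℂ}
    (ha : Summable fun n => ‖a n‖ ^ 2) :
    ∃ u : Space d → ℂ, MemL2per u ∧ ∀ n, fourierCoeffPer u n = a n := by
  obtain ⟨f, hf⟩ := exists_repr_eq (fourierBasis d) ha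
  obtain ⟨u, hu, rfl⟩ := exists_memL2per_toLp_eq f
  exact ⟨u, hu, fun n => by rw [← hf, fourierBasis_repr]⟩

/-- `perDeriv` is a choice with default value `0`; square summability of `n_j û(n)` provides a
candidate by Riesz–Fischer and thus rules out the default. -/
theorem isPerDeriv_perDeriv {u : Space d → ℂ} {j : Fin d}
    (h : Summable fun n : Fin d → ℤ => ‖(n j : ℂ) * fourierCoeffPer u n‖ ^ 2) :
    IsPerDeriv j u (perDeriv j u) := by
  have hex : ∃ w, IsPerDeriv j u w := by
    obtain ⟨w, hw, hw'⟩ := exists_memL2per_fourierCoeffPer_eq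
      (a := fun n => Complex.I * (n j : ℂ) * fourierCoeffPer u n)
      (by simpa [mul_assoc] using h)
    exact ⟨w, hw, hw'⟩
  rw [perDeriv, dif_pos hex]
  exact hex.choose_spec

theorem memL2per_shiftedDeriv {u : Space d → ℂ} (hu : MemL2per u) {j : Fin d} (η : Space d)
    (h : Summable fun n : Fin d → ℤ => ‖(n j : ℂ) * fourierCoeffPer u n‖ ^ 2) :
    MemL2per (shiftedDeriv η j u) ∧ ∀ n, fourierCoeffPer (shiftedDeriv η j u) n =
      Complex.I * ((n j : ℂ) + (η j : ℂ)) * fourierCoeffPer u n := by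
  have h1 := isPerDeriv_perDeriv h
  refine ⟨h1.1.add (hu.const_mul _), fun n => ?_⟩
  unfold shiftedDeriv
  rw [fourierCoeffPer_add h1.1 (hu.const_mul _), fourierCoeffPer_const_mul hu, h1.2]
  ring

/-- The weight `1 + |n|²`. -/
def weight (n : Fin d → ℤ) : ℝ := 1 + ∑ j, (n j : ℝ) ^ 2

theorem one_le_weight (n : Fin d → ℤ) : 1 ≤ weight n := by
  have : 0 ≤ ∑ j, (n j : ℝ) ^ 2 := Finset.sum_nonneg fun j _ => sq_nonneg _
  unfold weight; linarith

theorem weight_pos (n : Fin d → ℤ) : 0 < weight n := one_pos.trans_le (one_le_weight n)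

theorem sq_le_weight (n : Fin d → ℤ) (j : Fin d) : (n j : ℝ) ^ 2 ≤ weight n := by
  have := Finset.single_le_sum (f := fun j => (n j : ℝ) ^ 2) (fun j _ => sq_nonneg _)
    (Finset.mem_univ j)
  unfold weight; linarith

theorem abs_le_weight (n : Fin d → ℤ) (j : Fin d) : |(n j : ℝ)| ≤ weight n := by
  refine abs_le_of_sq_le_sq ?_ (weight_pos n).le
  nlinarith [sq_le_weight n j, one_le_weight n]

theorem MemH2per.summable_weight {u : Space d → ℂ} (hu : MemH2per u) :
    Summable fun n => ‖(weight n : ℂ) * fourierCoeffPer u n‖ ^ 2 := by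
  refine hu.2.congr fun n => ?_
  rw [norm_mul, mul_pow, Complex.norm_real, Real.norm_eq_abs, sq_abs, weight]

theorem MemH2per.summable_of_le {u : Space d → ℂ} (hu : MemH2per u) {a : (Fin d → ℤ) → ℂ}
    {C : ℝ} (ha : ∀ n, ‖a n‖ ≤ C * weight n) :
    Summable fun n => ‖a n * fourierCoeffPer u n‖ ^ 2 := by
  refine (hu.summable_weight.mul_left (C ^ 2)).of_nonneg_of_le (fun n => by positivity) fun n => ?_
  rw [norm_mul, norm_mul, Complex.norm_real, Real.norm_of_nonneg (weight_pos n).le, ← mul_pow,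
    ← mul_assoc]
  gcongr
  exact ha n

theorem MemH2per.shiftedDeriv {u : Space d → ℂ} (hu : MemH2per u) (η : Space d) (j : Fin d) :
    MemL2per (shiftedDeriv η j u) ∧ ∀ n, fourierCoeffPer (shiftedDeriv η j u) n =
      Complex.I * ((n j : ℂ) + (η j : ℂ)) * fourierCoeffPer u n := by
  refine memL2per_shiftedDeriv hu.1 η (hu.summable_of_le (C := 1) fun n => ?_)
  rw [one_mul]
  simpa using abs_le_weight n j

theorem MemH2per.shiftedLaplacian {u : Space d → ℂ} (hu : MemH2per u) (η : Space d) :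
    MemL2per (shiftedLaplacian η u) ∧ ∀ n, fourierCoeffPer (shiftedLaplacian η u) n =
      -(∑ j, ((n j : ℂ) + (η j : ℂ)) ^ 2) * fourierCoeffPer u n := by
  have key : ∀ j, MemL2per (BlochHomogenization.shiftedDeriv η j
      (BlochHomogenization.shiftedDeriv η j u)) ∧ ∀ n,
      fourierCoeffPer (BlochHomogenization.shiftedDeriv η j
        (BlochHomogenization.shiftedDeriv η j u)) n =
      -((n j : ℂ) + (η j : ℂ)) ^ 2 * fourierCoeffPer u n := fun j => by
    obtain ⟨h1, h2⟩ := hu.shiftedDeriv η j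
    have h3 : Summable fun n : Fin d → ℤ => ‖(n j : ℂ) *
        fourierCoeffPer (BlochHomogenization.shiftedDeriv η j u) n‖ ^ 2 := by
      simp only [h2, ← mul_assoc]
      -- Here `|n_j| (|n_j| + |η_j|) ≤ (1 + |η_j|)(1 + |n|²)`, as both `n_j²` and `|n_j|` are at
      -- most the weight.
      refine hu.summable_of_le (C := 1 + |η j|) fun n => ?_
      have h4 : ‖(n j : ℂ)‖ = |(n j : ℝ)| := by simp
      have h5 : ‖(n j : ℂ) + (η j : ℂ)‖ ≤ |(n j : ℝ)| + |η j| := by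
        refine (norm_add_le _ _).trans_eq ?_
        rw [h4, Complex.norm_real, Real.norm_eq_abs]
      rw [norm_mul, norm_mul, Complex.norm_I, mul_one, h4]
      have h6 := sq_le_weight n j
      have h7 := abs_le_weight n j
      rw [← sq_abs] at h6
      nlinarith [abs_nonneg (n j : ℝ), abs_nonneg (η j)]
    obtain ⟨h4, h5⟩ := memL2per_shiftedDeriv h1 η h3
    refine ⟨h4, fun n => ?_⟩
    rw [h5, h2]
    linear_combination ((n j : ℂ) + (η j : ℂ)) ^ 2 * fourierCoeffPer u n * Complex.I_sq
  obtain ⟨h1, h2⟩ := MemL2per.sum (s := Finset.univ) fun j _ => (key j).1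
  refine ⟨h1, fun n => ?_⟩
  unfold BlochHomogenization.shiftedLaplacian
  rw [h2, neg_mul, Finset.sum_mul, ← Finset.sum_neg_distrib]
  exact Finset.sum_congr rfl fun j _ => by rw [(key j).2, neg_mul]

end Derivatives

/-! ### The Bloch operator on `L²` of the cell -/

section Operators

variable {d : ℕ}

local notation "⟪" x ", " y "⟫" => inner ℂ x y

/-- The multiplier `1 / (1 + |n|²)`. -/
def besselOp (d : ℕ) : CellL2 d →L[ℂ] CellL2 d :=
  multiplier (fourierBasis d) (fun n => ((weight n)⁻¹ : ℝ)) fun n => by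
    rw [Complex.norm_real, Real.norm_of_nonneg (inv_nonneg.mpr (weight_pos n).le)]
    exact inv_le_one_of_one_le₀ (one_le_weight n)

/-- The multiplier `i n_j / (1 + |n|²)`. -/
def derivOpZero (j : Fin d) : CellL2 d →L[ℂ] CellL2 d :=
  multiplier (fourierBasis d) (fun n => Complex.I * ((n j / weight n : ℝ) : ℂ)) fun n => by
    rw [norm_mul, Complex.norm_I, one_mul, Complex.norm_real, Real.norm_eq_abs, abs_div,
      abs_of_pos (weight_pos n)]
    exact (div_le_one (weight_pos n)).mpr (abs_le_weight n j)

/-- The multiplier `-|n|² / (1 + |n|²)`. -/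
def laplaceOpZero (d : ℕ) : CellL2 d →L[ℂ] CellL2 d :=
  multiplier (fourierBasis d) (fun n => ((-(∑ j, (n j : ℝ) ^ 2) / weight n : ℝ) : ℂ)) fun n => by
    have h : 0 ≤ ∑ j, (n j : ℝ) ^ 2 := Finset.sum_nonneg fun j _ => sq_nonneg _
    rw [Complex.norm_real, Real.norm_eq_abs, abs_div, abs_neg, abs_of_nonneg h,
      abs_of_pos (weight_pos n)]
    exact (div_le_one (weight_pos n)).mpr (by unfold weight; linarith)

/-- The multiplier of `∂_j + iη_j`, preconditioned by `besselOp`. -/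
def derivOp (η : Space d) (j : Fin d) : CellL2 d →L[ℂ] CellL2 d :=
  derivOpZero j + (Complex.I * (η j : ℂ)) • besselOp d

/-- The multiplier of `(∇ + iη)²`, preconditioned by `besselOp`. -/
def laplaceOp (η : Space d) : CellL2 d →L[ℂ] CellL2 d :=
  laplaceOpZero d + ∑ j, (2 * Complex.I * (η j : ℂ)) • derivOpZero j
    - (∑ j, (η j : ℂ) ^ 2) • besselOp d

theorem repr_besselOp (h : CellL2 d) (n : Fin d → ℤ) :
    (fourierBasis d).repr (besselOp d h) n = (weight n : ℂ)⁻¹ * (fourierBasis d).repr h n := by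
  rw [besselOp, repr_multiplier, Complex.ofReal_inv]

theorem repr_derivOpZero (j : Fin d) (h : CellL2 d) (n : Fin d → ℤ) :
    (fourierBasis d).repr (derivOpZero j h) n =
      Complex.I * (n j : ℂ) * (weight n : ℂ)⁻¹ * (fourierBasis d).repr h n := by
  rw [derivOpZero, repr_multiplier]
  push_cast
  ring

theorem repr_derivOp (η : Space d) (j : Fin d) (h : CellL2 d) (n : Fin d → ℤ) :
    (fourierBasis d).repr (derivOp η j h) n =
      Complex.I * ((n j : ℂ) + (η j : ℂ)) * (weight n : ℂ)⁻¹ * (fourierBasis d).repr h n := by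
  simp only [derivOp, add_apply, smul_apply, map_add, map_smul, lp.coeFn_add, lp.coeFn_smul,
    Pi.add_apply, Pi.smul_apply, repr_derivOpZero, repr_besselOp, smul_eq_mul]
  ring

theorem repr_sum (s : Finset (Fin d)) (F : Fin d → CellL2 d) (n : Fin d → ℤ) :
    (fourierBasis d).repr (∑ j ∈ s, F j) n = ∑ j ∈ s, (fourierBasis d).repr (F j) n := by
  rw [map_sum, lp.coeFn_sum, Finset.sum_apply]

theorem repr_laplaceOp (η : Space d) (h : CellL2 d) (n : Fin d → ℤ) :
    (fourierBasis d).repr (laplaceOp η h) n =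
      -(∑ j, ((n j : ℂ) + (η j : ℂ)) ^ 2) * (weight n : ℂ)⁻¹ * (fourierBasis d).repr h n := by
  have h1 : (fourierBasis d).repr (laplaceOpZero d h) n =
      -(∑ j, (n j : ℂ) ^ 2) * (weight n : ℂ)⁻¹ * (fourierBasis d).repr h n := by
    rw [laplaceOpZero, repr_multiplier]
    push_cast
    ring
  have h2 : ∀ j, ((n j : ℂ) + (η j : ℂ)) ^ 2 =
      (n j : ℂ) ^ 2 + 2 * (n j : ℂ) * (η j : ℂ) + (η j : ℂ) ^ 2 := fun j => by ring
  simp only [laplaceOp, add_apply, sub_apply, sum_apply, smul_apply, map_add, map_sub, map_smul,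
    lp.coeFn_add, lp.coeFn_sub, lp.coeFn_smul, Pi.add_apply, Pi.sub_apply, Pi.smul_apply,
    repr_sum, h1, repr_derivOpZero, repr_besselOp, smul_eq_mul, h2, Finset.sum_add_distrib]
  have h3 : ∑ j, 2 * Complex.I * (η j : ℂ) *
      (Complex.I * (n j : ℂ) * (weight n : ℂ)⁻¹ * (fourierBasis d).repr h n) =
      -(∑ j, 2 * (n j : ℂ) * (η j : ℂ)) * (weight n : ℂ)⁻¹ * (fourierBasis d).repr h n := by
    rw [← Finset.sum_neg_distrib, Finset.sum_mul, Finset.sum_mul]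
    refine Finset.sum_congr rfl fun j _ => ?_
    linear_combination 2 * (η j : ℂ) * (n j : ℂ) * (weight n : ℂ)⁻¹ *
      (fourierBasis d).repr h n * Complex.I_sq
  rw [h3]
  ring

/-- The operators are polynomial in `η` with fixed bounded coefficients, which makes continuity in
operator norm immediate; this is the purpose of separating `derivOpZero`, `laplaceOpZero` and
`besselOp`. -/
theorem continuous_derivOp (j : Fin d) : Continuous fun η : Space d => derivOp η j := by
  unfold derivOp; fun_prop

theorem continuous_laplaceOp : Continuous fun η : Space d => laplaceOp η := by
  unfold laplaceOp; fun_prop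

/-- `u ∈ H²_♯(Y)` is represented by the element of `L²` with Fourier coefficients
`(1 + |n|²) û(n)`. -/
def Represents (h : CellL2 d) (u : Space d → ℂ) : Prop :=
  MemH2per u ∧ ∀ n, (fourierBasis d).repr h n = (weight n : ℂ) * fourierCoeffPer u n

theorem MemH2per.exists_represents {u : Space d → ℂ} (hu : MemH2per u) :
    ∃ h, Represents h u := by
  obtain ⟨h, hh⟩ := exists_repr_eq (fourierBasis d) hu.summable_weight
  exact ⟨h, hu, hh⟩

theorem exists_represents_of_cellL2 (h : CellL2 d) : ∃ u, Represents h u := by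
  obtain ⟨u, hu, hu'⟩ := exists_memL2per_toLp_eq (besselOp d h)
  have key : ∀ n, (fourierBasis d).repr h n = (weight n : ℂ) * fourierCoeffPer u n := fun n => by
    rw [← fourierBasis_repr hu.memLp, hu', repr_besselOp, ← mul_assoc, mul_inv_cancel₀, one_mul]
    exact_mod_cast (weight_pos n).ne'
  refine ⟨u, ⟨hu, ?_⟩, key⟩
  refine (hasSum_norm_sq_repr (fourierBasis d) h).summable.congr fun n => ?_
  rw [key, norm_mul, mul_pow, Complex.norm_real, Real.norm_eq_abs, sq_abs, weight]

theorem Represents.fourierCoeffPer_eq {h : CellL2 d} {u : Space d → ℂ} (hu : Represents h u)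
    (n : Fin d → ℤ) : fourierCoeffPer u n = (weight n : ℂ)⁻¹ * (fourierBasis d).repr h n := by
  rw [hu.2, ← mul_assoc, inv_mul_cancel₀, one_mul]
  exact_mod_cast (weight_pos n).ne'

theorem Represents.toLp_eq {h : CellL2 d} {u : Space d → ℂ} (hu : Represents h u) :
    hu.1.1.toLp = besselOp d h :=
  hu.1.1.toLp_eq fun n => by rw [hu.fourierCoeffPer_eq, repr_besselOp]

theorem Represents.shiftedDeriv_toLp_eq {h : CellL2 d} {u : Space d → ℂ} (hu : Represents h u)
    (η : Space d) (j : Fin d) : (hu.1.shiftedDeriv η j).1.toLp = derivOp η j h :=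
  (hu.1.shiftedDeriv η j).1.toLp_eq fun n => by
    rw [(hu.1.shiftedDeriv η j).2, hu.fourierCoeffPer_eq, repr_derivOp, mul_assoc]
    ring

theorem Represents.shiftedLaplacian_toLp_eq {h : CellL2 d} {u : Space d → ℂ}
    (hu : Represents h u) (η : Space d) : (hu.1.shiftedLaplacian η).1.toLp = laplaceOp η h :=
  (hu.1.shiftedLaplacian η).1.toLp_eq fun n => by
    rw [(hu.1.shiftedLaplacian η).2, hu.fourierCoeffPer_eq, repr_laplaceOp]
    ring

theorem besselOp_injective : Function.Injective (besselOp d) := by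
  intro f g hfg
  refine (fourierBasis d).repr.injective ?_
  ext n
  have := congrArg (fun F => (fourierBasis d).repr F n) hfg
  simp only [repr_besselOp] at this
  exact mul_left_cancel₀ (inv_ne_zero (by exact_mod_cast (weight_pos n).ne')) this

theorem Represents.ae_eq_iff {h h' : CellL2 d} {u u' : Space d → ℂ} (hu : Represents h u)
    (hu' : Represents h' u') : u =ᵐ[volume] u' ↔ h = h' := by
  rw [← besselOp_injective.eq_iff, ← hu.toLp_eq, ← hu'.toLp_eq, MemL2per.toLp, MemL2per.toLp,
    MemLp.toLp_eq_toLp_iff, EventuallyEq, EventuallyEq, ae_cellMeasure_iff]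
  exact ⟨fun h => ae_restrict_of_ae h, fun h => ae_eq_of_ae_eq_cell hu.1.1.1 hu'.1.1.1 h⟩

theorem Represents.const_mul {h : CellL2 d} {u : Space d → ℂ} (hu : Represents h u) (c : ℂ) :
    Represents (c • h) fun y => c * u y := by
  refine ⟨⟨hu.1.1.const_mul c, ?_⟩, fun n => ?_⟩
  · refine (hu.1.2.mul_left (‖c‖ ^ 2)).congr fun n => ?_
    rw [fourierCoeffPer_const_mul hu.1.1, norm_mul]
    ring
  · rw [fourierCoeffPer_const_mul hu.1.1, map_smul, lp.coeFn_smul, Pi.smul_apply, hu.2,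
      smul_eq_mul]
    ring

theorem represents_zero : Represents (0 : CellL2 d) 0 := by
  have h0 : ∀ n : Fin d → ℤ, fourierCoeffPer (0 : Space d → ℂ) n = 0 := fun n => by
    simp [fourierCoeffPer]
  exact ⟨⟨memL2per_const 0, by simp [h0]⟩, fun n => by simp [h0]⟩

variable {A : Space d → Matrix (Fin d) (Fin d) ℝ}

theorem IsAdmissible.memLp_entry (hA : IsAdmissible A) (j k : Fin d) :
    MemLp (fun y => (A y j k : ℂ)) ⊤ (cellMeasure d) := by
  obtain ⟨M, hM⟩ := hA.bounded
  refine memLp_top_of_bound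
    (Complex.measurable_ofReal.comp (hA.measurable j k)).aestronglyMeasurable M ?_
  rw [ae_cellMeasure_iff]
  filter_upwards [ae_restrict_of_ae hM] with y hy
  rw [Complex.norm_real]
  exact hy j k

/-- Multiplication by the entry `a_{jk}` on `L²` of the cell. -/
def entryOp (hA : IsAdmissible A) (j k : Fin d) : CellL2 d →L[ℂ] CellL2 d :=
  (ContinuousLinearMap.mul ℂ ℂ).holderL (cellMeasure d) ⊤ 2 2 ((hA.memLp_entry j k).toLp _)

theorem coeFn_entryOp (hA : IsAdmissible A) (j k : Fin d) (F : CellL2 d) :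
    entryOp hA j k F =ᵐ[cellMeasure d] fun y => (A y j k : ℂ) * F y := by
  have h1 := (ContinuousLinearMap.mul ℂ ℂ).coeFn_holder (r := 2)
    ((hA.memLp_entry j k).toLp _) F
  filter_upwards [h1, (hA.memLp_entry j k).coeFn_toLp] with y hy1 hy2
  change ((ContinuousLinearMap.mul ℂ ℂ).holder 2 _ F : Space d → ℂ) y = _
  rw [hy1, hy2]
  rfl

theorem inner_entryOp_left (hA : IsAdmissible A) (j k : Fin d) (F G : CellL2 d) :
    ⟪entryOp hA j k F, G⟫ = ⟪F, entryOp hA j k G⟫ := by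
  rw [L2.inner_def, L2.inner_def]
  refine integral_congr_ae ?_
  filter_upwards [coeFn_entryOp hA j k F, coeFn_entryOp hA j k G] with y h1 h2
  rw [h1, h2, RCLike.inner_apply, RCLike.inner_apply, map_mul, Complex.conj_ofReal]
  ring

/-- Symmetry of `A` enters here, and through it the self-adjointness of `blochOp`. -/
theorem entryOp_comm (hA : IsAdmissible A) (j k : Fin d) : entryOp hA j k = entryOp hA k j := by
  ext1 F
  refine Lp.ext ?_
  have h := ae_cellMeasure_iff.mpr (ae_restrict_of_ae (s := cell d) hA.symmetric)
  filter_upwards [coeFn_entryOp hA j k F, coeFn_entryOp hA k j F, h] with y h1 h2 h3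
  rw [h1, h2, h3.apply]

/-- The operator of the shifted Bloch form, preconditioned by `besselOp`. -/
def blochOp (hA : IsAdmissible A) (ρ : ℝ) (η : Space d) : CellL2 d →L[ℂ] CellL2 d :=
  (∑ j, ∑ k, (derivOp η j).adjoint ∘L entryOp hA j k ∘L derivOp η k)
    + (ρ : ℂ) ^ 2 • ((laplaceOp η).adjoint ∘L laplaceOp η)

/-- The operator of the `L²` form, preconditioned by `besselOp`. -/
def massOp (d : ℕ) : CellL2 d →L[ℂ] CellL2 d := (besselOp d).adjoint ∘L besselOp d

theorem inner_blochOp (hA : IsAdmissible A) (ρ : ℝ) (η : Space d) (g h : CellL2 d) :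
    ⟪g, blochOp hA ρ η h⟫ = (∑ j, ∑ k, ⟪derivOp η j g, entryOp hA j k (derivOp η k h)⟫)
      + (ρ : ℂ) ^ 2 * ⟪laplaceOp η g, laplaceOp η h⟫ := by
  simp only [blochOp, add_apply, sum_apply, smul_apply, inner_add_right, inner_sum,
    inner_smul_right, ContinuousLinearMap.comp_apply, ContinuousLinearMap.adjoint_inner_right]

theorem inner_massOp (g h : CellL2 d) : ⟪g, massOp d h⟫ = ⟪besselOp d g, besselOp d h⟫ := by
  simp only [massOp, ContinuousLinearMap.comp_apply, ContinuousLinearMap.adjoint_inner_right]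

theorem isSelfAdjoint_massOp : IsSelfAdjoint (massOp d) :=
  ContinuousLinearMap.isSelfAdjoint_iff_isSymmetric.mpr fun g h => by
    change ⟪massOp d g, h⟫ = ⟪g, massOp d h⟫
    rw [← inner_conj_symm, inner_massOp, inner_massOp, inner_conj_symm]

theorem inner_blochOp_symm (hA : IsAdmissible A) (ρ : ℝ) (η : Space d) (g h : CellL2 d) :
    ⟪blochOp hA ρ η g, h⟫ = ⟪g, blochOp hA ρ η h⟫ := by
  rw [← inner_conj_symm, inner_blochOp, inner_blochOp, map_add, map_sum, map_mul, map_pow,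
    Complex.conj_ofReal, inner_conj_symm]
  refine congrArg (· + (ρ : ℂ) ^ 2 * ⟪laplaceOp η g, laplaceOp η h⟫) ?_
  rw [Finset.sum_comm]
  simp only [map_sum, inner_conj_symm]
  exact Finset.sum_congr rfl fun j _ => Finset.sum_congr rfl fun k _ => by
    rw [inner_entryOp_left, entryOp_comm]

theorem isSelfAdjoint_blochOp (hA : IsAdmissible A) (ρ : ℝ) (η : Space d) :
    IsSelfAdjoint (blochOp hA ρ η) :=
  ContinuousLinearMap.isSelfAdjoint_iff_isSymmetric.mpr fun g h => inner_blochOp_symm hA ρ η g h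

theorem re_inner_massOp (h : CellL2 d) : (⟪massOp d h, h⟫).re = ‖besselOp d h‖ ^ 2 := by
  have h1 : ⟪massOp d h, h⟫ = ⟪h, massOp d h⟫ :=
    (ContinuousLinearMap.isSelfAdjoint_iff_isSymmetric.mp isSelfAdjoint_massOp) h h
  rw [h1, inner_massOp]
  exact inner_self_eq_norm_sq (𝕜 := ℂ) _

theorem norm_massOp_le : ‖massOp d‖ ≤ 1 := by
  have h1 : ‖besselOp d‖ ≤ 1 := norm_multiplier_le _ _ _
  refine (ContinuousLinearMap.opNorm_comp_le _ _).trans ?_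
  rw [LinearIsometryEquiv.norm_map]
  exact mul_le_one₀ h1 (norm_nonneg _) h1

theorem continuous_blochOp (hA : IsAdmissible A) (ρ : ℝ) :
    Continuous fun η => blochOp hA ρ η := by
  have h1 := fun j => continuous_derivOp (d := d) j
  have h2 := continuous_laplaceOp (d := d)
  have h3 : Continuous (ContinuousLinearMap.adjoint (𝕜 := ℂ) (E := CellL2 d) (F := CellL2 d)) :=
    LinearIsometryEquiv.continuous _
  unfold blochOp
  have h4 : Continuous fun η : Space d => (laplaceOp η).adjoint ∘L laplaceOp η :=
    (h3.comp h2).clm_comp h2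
  refine Continuous.add (continuous_finsetSum _ fun j _ => continuous_finsetSum _ fun k _ => ?_)
    (h4.const_smul ((ρ : ℂ) ^ 2))
  exact (h3.comp (h1 j)).clm_comp (continuous_const.clm_comp (h1 k))

theorem conj_toLp_mul_toLp {u v : Space d → ℂ} (hu : MemL2per u) (hv : MemL2per v) :
    ∫ y in cell d, u y * conj (v y) = (volume (cell d)).toReal * ⟪hv.toLp, hu.toLp⟫ := by
  rw [integral_cell_eq, L2.inner_def, Complex.real_smul]
  congr 1
  refine integral_congr_ae ?_
  filter_upwards [hu.coeFn_toLp, hv.coeFn_toLp] with y h1 h2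
  rw [h1, h2, RCLike.inner_apply]

theorem blochForm_eq (hA : IsAdmissible A) (ρ : ℝ) (η : Space d) {g h : CellL2 d}
    {u v : Space d → ℂ} (hu : Represents h u) (hv : Represents g v) :
    blochForm A ρ η u v = (volume (cell d)).toReal * ⟪g, blochOp hA ρ η h⟫ := by
  rw [blochForm, conj_toLp_mul_toLp (hu.1.shiftedLaplacian η).1 (hv.1.shiftedLaplacian η).1,
    hu.shiftedLaplacian_toLp_eq, hv.shiftedLaplacian_toLp_eq, inner_blochOp, mul_add]
  congr 1
  · rw [integral_cell_eq, Complex.real_smul]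
    congr 1
    have h1 : ∀ j k, ⟪derivOp η j g, entryOp hA j k (derivOp η k h)⟫ =
        ∫ y, ⟪derivOp η j g y, entryOp hA j k (derivOp η k h) y⟫ ∂cellMeasure d :=
      fun j k => L2.inner_def _ _
    simp only [h1]
    rw [integral_congr_ae (g := fun y => ∑ j, ∑ k,
      ⟪derivOp η j g y, entryOp hA j k (derivOp η k h) y⟫)]
    · rw [integral_finsetSum _ fun j _ => integrable_finsetSum _ fun k _ =>
        L2.integrable_inner _ _]
      exact Finset.sum_congr rfl fun j _ =>
        integral_finsetSum _ fun k _ => L2.integrable_inner _ _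
    · have h2 : ∀ j, (derivOp η j g : CellL2 d) =ᵐ[cellMeasure d] shiftedDeriv η j v := fun j => by
        rw [← hv.shiftedDeriv_toLp_eq η j]; exact (hv.1.shiftedDeriv η j).1.coeFn_toLp
      have h3 : ∀ j, (derivOp η j h : CellL2 d) =ᵐ[cellMeasure d] shiftedDeriv η j u := fun j => by
        rw [← hu.shiftedDeriv_toLp_eq η j]; exact (hu.1.shiftedDeriv η j).1.coeFn_toLp
      filter_upwards [eventually_all.mpr h2, eventually_all.mpr h3, eventually_all.mpr fun j =>
        eventually_all.mpr fun k => coeFn_entryOp hA j k (derivOp η k h)] with y hy2 hy3 hy4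
      refine Finset.sum_congr rfl fun j _ => Finset.sum_congr rfl fun k _ => ?_
      rw [hy4, hy2, hy3, RCLike.inner_apply]
  · ring

/-- Test functions in `H²_♯` correspond exactly to vectors of `L²`, so the weak formulation says
that two vectors have the same inner product with every vector. The factor `|Y|` comes from the
normalized measure and cancels. -/
theorem Represents.isBlochEigenpair_iff (hA : IsAdmissible A) {ρ : ℝ} {η : Space d} {lam : ℝ}
    {h : CellL2 d} {u : Space d → ℂ} (hu : Represents h u) :
    IsBlochEigenpair A ρ η lam u ↔ h ≠ 0 ∧ blochOp hA ρ η h = (lam : ℂ) • massOp d h := by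
  have hvol : ((volume (cell d)).toReal : ℂ) ≠ 0 := by
    exact_mod_cast (ENNReal.toReal_pos volume_cell_ne_zero volume_cell_ne_top).ne'
  have key : ∀ {g : CellL2 d} {v : Space d → ℂ}, Represents g v →
      (blochForm A ρ η u v = (lam : ℂ) * ∫ y in cell d, u y * conj (v y) ↔
        ⟪g, blochOp hA ρ η h⟫ = ⟪g, (lam : ℂ) • massOp d h⟫) := fun {g v} hv => by
    rw [blochForm_eq hA ρ η hu hv, conj_toLp_mul_toLp hu.1.1 hv.1.1, hu.toLp_eq, hv.toLp_eq,
      inner_smul_right, inner_massOp, mul_left_comm, mul_right_inj' hvol]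
  constructor
  · rintro ⟨_, h0, hform⟩
    refine ⟨fun hh => h0 ((hu.ae_eq_iff represents_zero).mpr hh), ext_inner_left ℂ fun g => ?_⟩
    obtain ⟨v, hv⟩ := exists_represents_of_cellL2 g
    exact (key hv).mp (hform v hv.1)
  · rintro ⟨h0, heq⟩
    refine ⟨hu.1, fun hh => h0 ((hu.ae_eq_iff represents_zero).mp hh), fun v hv => ?_⟩
    obtain ⟨g, hg⟩ := hv.exists_represents
    exact (key hg).mpr (by rw [heq])

end Operators

/-! ### Coercivity of the Bloch operator off the constants -/

section Coercivity

variable {d : ℕ} {A : Space d → Matrix (Fin d) (Fin d) ℝ}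

local notation "⟪" x ", " y "⟫" => inner ℂ x y

/-- The constant function `1` as an element of `L²` of the cell. -/
def constOne (d : ℕ) : CellL2 d := fourierBasis d 0

theorem norm_constOne : ‖constOne d‖ = 1 := (fourierBasis d).orthonormal.1 0

theorem inner_constOne (h : CellL2 d) : ⟪constOne d, h⟫ = (fourierBasis d).repr h 0 :=
  ((fourierBasis d).repr_apply_apply h 0).symm

theorem repr_constOne (n : Fin d → ℤ) :
    (fourierBasis d).repr (constOne d) n = if n = 0 then 1 else 0 := by
  classical
  rw [constOne, HilbertBasis.repr_self, lp.coeFn_single, Pi.single_apply]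

theorem weight_zero : weight (0 : Fin d → ℤ) = 1 := by simp [weight]

theorem besselOp_constOne : besselOp d (constOne d) = constOne d := by
  refine (fourierBasis d).repr.injective ?_
  ext n
  rw [repr_besselOp, repr_constOne]
  split_ifs with hn
  · simp [hn, weight_zero]
  · simp

theorem derivOp_constOne (η : Space d) (j : Fin d) :
    derivOp η j (constOne d) = (Complex.I * (η j : ℂ)) • constOne d := by
  refine (fourierBasis d).repr.injective ?_
  ext n
  rw [repr_derivOp, map_smul, lp.coeFn_smul, Pi.smul_apply, repr_constOne]
  split_ifs with hn
  · simp [hn, weight_zero]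
  · simp

theorem laplaceOp_constOne (η : Space d) :
    laplaceOp η (constOne d) = (-(‖η‖ ^ 2 : ℝ) : ℂ) • constOne d := by
  refine (fourierBasis d).repr.injective ?_
  ext n
  rw [repr_laplaceOp, map_smul, lp.coeFn_smul, Pi.smul_apply, repr_constOne,
    EuclideanSpace.real_norm_sq_eq]
  split_ifs with hn
  · simp [hn, weight_zero]
  · simp

/-- A bound for the coefficient matrix. -/
def entryBound (hA : IsAdmissible A) : ℝ := ∑ j, ∑ k, ‖entryOp hA j k‖

theorem entryBound_nonneg (hA : IsAdmissible A) : 0 ≤ entryBound hA :=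
  Finset.sum_nonneg fun _ _ => Finset.sum_nonneg fun _ _ => norm_nonneg _

/-- An upper bound for the first Bloch eigenvalue. -/
def eigenBound (hA : IsAdmissible A) (ρ : ℝ) (η : Space d) : ℝ :=
  ρ ^ 2 * (‖η‖ ^ 2) ^ 2 + entryBound hA * ‖η‖ ^ 2

/-- On constants `∇ + iη` acts as multiplication by `iη`. The fourth order part thus contributes
exactly `ρ²|η|⁴`; keeping it exact is what later makes the estimates uniform in `ρ`. -/
theorem re_inner_blochOp_constOne_le (hA : IsAdmissible A) (ρ : ℝ) (η : Space d) :
    (⟪blochOp hA ρ η (constOne d), constOne d⟫).re ≤ eigenBound hA ρ η := by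
  have hη : ∀ j, ‖η j‖ ≤ ‖η‖ := fun j => PiLp.norm_apply_le η j
  rw [inner_blochOp_symm, inner_blochOp, add_comm, Complex.add_re, eigenBound]
  refine add_le_add (le_of_eq ?_) ?_
  · rw [laplaceOp_constOne, inner_self_eq_norm_sq_to_K, norm_smul, norm_constOne, norm_neg,
      Complex.norm_real, norm_pow, norm_norm, mul_one]
    norm_cast
    exact Complex.re_ofReal_mul _ _
  · rw [entryBound, Finset.sum_mul, Complex.re_sum]
    refine Finset.sum_le_sum fun j _ => ?_
    rw [Finset.sum_mul, Complex.re_sum]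
    refine Finset.sum_le_sum fun k _ => ?_
    refine (Complex.re_le_norm _).trans ((norm_inner_le_norm _ _).trans ?_)
    have h1 : ∀ j, ‖derivOp η j (constOne d)‖ ≤ ‖η‖ := fun j => by
      rw [derivOp_constOne, norm_smul, norm_constOne, norm_mul, Complex.norm_I, one_mul, mul_one,
        Complex.norm_real]
      exact hη j
    have h2 := (entryOp hA j k).le_opNorm (derivOp η k (constOne d))
    calc _ ≤ ‖η‖ * (‖entryOp hA j k‖ * ‖η‖) := by
          gcongr
          · exact h1 j
          · exact h2.trans (by gcongr; exact h1 k)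
      _ = _ := by ring

/-- Since `A` is real, the real part of the Hermitian form at a complex vector is the sum of the
real forms at its real and imaginary parts, and ellipticity applies to each. The lower bound
obtained is diagonal in the Fourier basis. -/
theorem le_re_inner_blochOp (hA : IsAdmissible A) {α : ℝ}
    (hα : ∀ᵐ y : Space d, ∀ ξ : Space d, α * ‖ξ‖ ^ 2 ≤ ∑ j, ∑ k, A y j k * ξ k * ξ j)
    (ρ : ℝ) (η : Space d) (h : CellL2 d) :
    α * ∑ j, ‖derivOp η j h‖ ^ 2 + ρ ^ 2 * ‖laplaceOp η h‖ ^ 2 ≤ (⟪blochOp hA ρ η h, h⟫).re := by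
  rw [inner_blochOp_symm, inner_blochOp, Complex.add_re]
  refine add_le_add ?_ (le_of_eq ?_)
  · have h1 : ∀ j k, ⟪derivOp η j h, entryOp hA j k (derivOp η k h)⟫ =
        ∫ y, ⟪derivOp η j h y, entryOp hA j k (derivOp η k h) y⟫ ∂cellMeasure d :=
      fun j k => L2.inner_def _ _
    have hint : ∀ j, Integrable (fun y => ‖derivOp η j h y‖ ^ 2) (cellMeasure d) := fun j =>
      (memLp_two_iff_integrable_sq_norm (Lp.memLp _).1).mp (Lp.memLp _)
    have h2 : ∀ j, ‖derivOp η j h‖ ^ 2 = ∫ y, ‖derivOp η j h y‖ ^ 2 ∂cellMeasure d := fun j => by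
      rw [← inner_self_eq_norm_sq (𝕜 := ℂ), L2.inner_def, ← integral_re (L2.integrable_inner _ _)]
      refine integral_congr_ae (Eventually.of_forall fun y => ?_)
      exact inner_self_eq_norm_sq (𝕜 := ℂ) _
    have hint2 : ∀ j k, Integrable (fun y =>
        ⟪derivOp η j h y, entryOp hA j k (derivOp η k h) y⟫) (cellMeasure d) :=
      fun j k => L2.integrable_inner _ _
    simp only [h1, h2]
    rw [← integral_finsetSum _ fun j _ => hint j, ← integral_const_mul,
      Finset.sum_congr rfl fun j _ => (integral_finsetSum _ fun k _ => hint2 j k).symm,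
      ← integral_finsetSum _ fun j _ => integrable_finsetSum _ fun k _ => hint2 j k]
    have h3 := integral_re (integrable_finsetSum Finset.univ fun j _ =>
      integrable_finsetSum Finset.univ fun k _ => hint2 j k)
    refine le_trans (integral_mono_ae ((integrable_finsetSum _ fun j _ => hint j).const_mul α)
      (integrable_finsetSum _ fun j _ => integrable_finsetSum _ fun k _ => hint2 j k).re ?_) h3.le
    have hα' := ae_cellMeasure_iff.mpr (ae_restrict_of_ae (s := cell d) hα)
    filter_upwards [hα', eventually_all.mpr fun j =>
      eventually_all.mpr fun k => coeFn_entryOp hA j k (derivOp η k h)] with y hy1 hy2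
    set x : Fin d → ℂ := fun j => derivOp η j h y with hx
    have hr := hy1 (WithLp.toLp 2 fun j => (x j).re)
    have hi := hy1 (WithLp.toLp 2 fun j => (x j).im)
    simp only [EuclideanSpace.real_norm_sq_eq] at hr hi
    have e1 : ∑ j, ‖derivOp η j h y‖ ^ 2 = ∑ j, (x j).re ^ 2 + ∑ j, (x j).im ^ 2 := by
      rw [← Finset.sum_add_distrib]
      refine Finset.sum_congr rfl fun j _ => ?_
      rw [← Complex.normSq_eq_norm_sq, Complex.normSq_apply]
      ring
    have e2 : RCLike.re (∑ j, ∑ k, ⟪derivOp η j h y, entryOp hA j k (derivOp η k h) y⟫) =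
        ∑ j, ∑ k, A y j k * (x k).re * (x j).re + ∑ j, ∑ k, A y j k * (x k).im * (x j).im := by
      change (∑ j, ∑ k, ⟪derivOp η j h y, entryOp hA j k (derivOp η k h) y⟫).re = _
      rw [← Finset.sum_add_distrib, Complex.re_sum]
      refine Finset.sum_congr rfl fun j _ => ?_
      rw [← Finset.sum_add_distrib, Complex.re_sum]
      refine Finset.sum_congr rfl fun k _ => ?_
      rw [hy2, RCLike.inner_apply, mul_assoc, Complex.re_ofReal_mul, Complex.mul_re,
        Complex.conj_re, Complex.conj_im]
      simp only [hx]
      ring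
    rw [e1, e2, mul_add]
    exact add_le_add hr hi
  · rw [← Complex.ofReal_pow, Complex.re_ofReal_mul]
    exact congrArg _ (inner_self_eq_norm_sq (𝕜 := ℂ) _).symm

/-- The symbol `|n + η|²` of the shifted Laplacian. -/
def shiftedSq (η : Space d) (n : Fin d → ℤ) : ℝ := ∑ j, ((n j : ℝ) + η j) ^ 2

/-- Parseval's identity reduces coercivity to an inequality between numbers for each frequency. -/
theorem hasSum_symbol (η : Space d) (α ρ Λ : ℝ) (h : CellL2 d) :
    HasSum (fun n => (α * shiftedSq η n + ρ ^ 2 * shiftedSq η n ^ 2 - Λ) * (weight n)⁻¹ ^ 2 *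
      ‖(fourierBasis d).repr h n‖ ^ 2)
      (α * ∑ j, ‖derivOp η j h‖ ^ 2 + ρ ^ 2 * ‖laplaceOp η h‖ ^ 2 - Λ * ‖besselOp d h‖ ^ 2) := by
  have hD := hasSum_sum fun j (_ : j ∈ Finset.univ) =>
    hasSum_norm_sq_repr (fourierBasis d) (derivOp η j h)
  have hL := hasSum_norm_sq_repr (fourierBasis d) (laplaceOp η h)
  have hJ := hasSum_norm_sq_repr (fourierBasis d) (besselOp d h)
  refine (((hD.mul_left α).add (hL.mul_left (ρ ^ 2))).sub (hJ.mul_left Λ)).congr_fun fun n => ?_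
  have h1 : ∀ j, ‖(n j : ℂ) + (η j : ℂ)‖ ^ 2 = ((n j : ℝ) + η j) ^ 2 := fun j => by
    have : (n j : ℂ) + (η j : ℂ) = (((n j : ℝ) + η j : ℝ) : ℂ) := by push_cast; rfl
    rw [this, Complex.norm_real, Real.norm_eq_abs, sq_abs]
  have h2 : ‖∑ j, ((n j : ℂ) + (η j : ℂ)) ^ 2‖ ^ 2 = shiftedSq η n ^ 2 := by
    have : ∑ j, ((n j : ℂ) + (η j : ℂ)) ^ 2 = (shiftedSq η n : ℂ) := by
      unfold shiftedSq; push_cast; rfl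
    rw [this, Complex.norm_real, Real.norm_eq_abs, sq_abs]
  simp only [repr_derivOp, repr_laplaceOp, repr_besselOp, norm_mul, mul_pow, norm_neg, h1, h2,
    norm_inv, Complex.norm_real, Complex.norm_I, Real.norm_of_nonneg (weight_pos n).le]
  rw [← Finset.sum_mul, ← Finset.sum_mul, ← Finset.mul_sum]
  change _ = α * (1 ^ 2 * shiftedSq η n * _ * _) + _ - _
  ring

/-- Smallness of the quasimomentum relative to the ellipticity. -/
structure IsSmall (hA : IsAdmissible A) (α : ℝ) (η : Space d) : Prop where
  norm_sq_le : ‖η‖ ^ 2 ≤ 1 / 16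
  bound_le : entryBound hA * ‖η‖ ^ 2 ≤ α / 2

theorem shiftedSq_lower (η : Space d) {n : Fin d → ℤ} (hn : n ≠ 0) (hη : ‖η‖ ^ 2 ≤ 1 / 16) :
    1 ≤ weight n - 1 ∧ 9 / 16 * (weight n - 1) ≤ shiftedSq η n := by
  have h1 : weight n - 1 = ∑ j, (n j : ℝ) ^ 2 := by rw [weight]; ring
  rw [h1]
  have h2 : 1 ≤ ∑ j, (n j : ℝ) ^ 2 := by
    obtain ⟨j, hj⟩ := Function.ne_iff.mp hn
    have h3 : (1 : ℝ) ≤ (n j : ℝ) ^ 2 := by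
      have : (1 : ℤ) ≤ (n j) ^ 2 := by
        have : (n j) ^ 2 ≠ 0 := pow_ne_zero 2 hj
        have := sq_nonneg (n j)
        omega
      exact_mod_cast this
    exact h3.trans (Finset.single_le_sum (f := fun j => (n j : ℝ) ^ 2)
      (fun j _ => sq_nonneg _) (Finset.mem_univ j))
  refine ⟨h2, ?_⟩
  -- Young's inequality: the difference is the sum of the squares `(n_j/2 + 2η_j)²`. Since `3|η|² ≤
  -- 3/16 ≤ (3/16)|n|²`, the factor `9/16` remains.
  have h3 : 3 / 4 * ∑ j, (n j : ℝ) ^ 2 - 3 * ‖η‖ ^ 2 ≤ shiftedSq η n := by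
    rw [EuclideanSpace.real_norm_sq_eq, Finset.mul_sum, Finset.mul_sum, ← Finset.sum_sub_distrib,
      shiftedSq]
    refine Finset.sum_le_sum fun j _ => ?_
    nlinarith [sq_nonneg ((n j : ℝ) / 2 + 2 * η j)]
  linarith

/-- The two orders are compared separately, so that no constant depends on `ρ`. In second order
`9α/16 - α/2 = α/16` is left. In fourth order, with `s = |n|² ≥ 1`, one has `|n + η|⁴ - |η|⁴ ≥
(5/16) s² ≥ (1 + s)²/16`. -/
theorem symbol_lower {hA : IsAdmissible A} {α : ℝ} (hα : 0 < α) {η : Space d}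
    (hη : IsSmall hA α η) (ρ : ℝ) {n : Fin d → ℤ} (hn : n ≠ 0) :
    α / 16 + ρ ^ 2 / 16 * weight n ^ 2 ≤
      α * shiftedSq η n + ρ ^ 2 * shiftedSq η n ^ 2 - eigenBound hA ρ η := by
  obtain ⟨h1, h2⟩ := shiftedSq_lower η hn hη.norm_sq_le
  have h3 := hη.norm_sq_le
  have h4 := hη.bound_le
  set s := weight n - 1
  have hs : weight n = 1 + s := by simp [s]
  set q := shiftedSq η n
  set r := ‖η‖ ^ 2
  have hr : 0 ≤ r := by positivity
  rw [eigenBound, hs]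
  have h5 : (9 / 16 * s) ^ 2 ≤ q ^ 2 := by gcongr
  have h6 : r ^ 2 ≤ (1 / 16 * s) ^ 2 := by gcongr; linarith
  have h7 : 1 / 16 * (1 + s) ^ 2 ≤ q ^ 2 - r ^ 2 := by nlinarith
  have h8 : ρ ^ 2 * (1 / 16 * (1 + s) ^ 2) ≤ ρ ^ 2 * (q ^ 2 - r ^ 2) := by gcongr
  have h9 : α * (9 / 16) ≤ α * q := by gcongr; linarith
  linarith

/-- Coercivity of the Bloch operator at the level `eigenBound` on functions of mean zero. -/
theorem coercive_blochOp {hA : IsAdmissible A} {α : ℝ} (hα0 : 0 < α)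
    (hα : ∀ᵐ y : Space d, ∀ ξ : Space d, α * ‖ξ‖ ^ 2 ≤ ∑ j, ∑ k, A y j k * ξ k * ξ j)
    {η : Space d} (hη : IsSmall hA α η) (ρ : ℝ) {h : CellL2 d} (hh : ⟪constOne d, h⟫ = 0) :
    ρ ^ 2 / 16 * ‖h‖ ^ 2 ≤
      (⟪blochOp hA ρ η h, h⟫).re - eigenBound hA ρ η * (⟪massOp d h, h⟫).re := by
  rw [re_inner_massOp]
  refine le_trans ?_ (sub_le_sub_right (le_re_inner_blochOp hA hα ρ η h) _)
  refine hasSum_le (fun n => ?_) ((hasSum_norm_sq_repr (fourierBasis d) h).mul_left _)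
    (hasSum_symbol η α ρ (eigenBound hA ρ η) h)
  by_cases hn : n = 0
  · rw [inner_constOne] at hh
    simp [hn, hh]
  · have h1 := symbol_lower hα0 hη ρ hn
    have hw := weight_pos n
    have h2 : ρ ^ 2 / 16 * weight n ^ 2 ≤
        α * shiftedSq η n + ρ ^ 2 * shiftedSq η n ^ 2 - eigenBound hA ρ η := by linarith
    gcongr
    -- The fourth order bound has the size of `weight n ^ 2` and so compensates the preconditioner.
    rw [inv_pow, ← div_eq_mul_inv, le_div_iff₀ (by positivity)]
    exact h2

/-- The deviation of a low eigenvector from its mean is of order `‖η‖`, uniformly in `ρ`. -/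
theorem norm_besselOp_sub_const_le {hA : IsAdmissible A} {α : ℝ} (hα0 : 0 < α)
    (hα : ∀ᵐ y : Space d, ∀ ξ : Space d, α * ‖ξ‖ ^ 2 ≤ ∑ j, ∑ k, A y j k * ξ k * ξ j)
    {η : Space d} (hη : IsSmall hA α η) {ρ lam : ℝ} (hlam : lam ≤ eigenBound hA ρ η)
    {c : CellL2 d} (hc1 : ⟪constOne d, c⟫ = 1)
    (hc : blochOp hA ρ η c = (lam : ℂ) • massOp d c) :
    ‖besselOp d c - constOne d‖ ^ 2 ≤ 16 * entryBound hA / α * ‖η‖ ^ 2 := by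
  have h1 : α * ∑ j, ‖derivOp η j c‖ ^ 2 + ρ ^ 2 * ‖laplaceOp η c‖ ^ 2
      - eigenBound hA ρ η * ‖besselOp d c‖ ^ 2 ≤ 0 := by
    have h2 := le_re_inner_blochOp hA hα ρ η c
    rw [hc, inner_smul_left, Complex.conj_ofReal, Complex.re_ofReal_mul, re_inner_massOp] at h2
    nlinarith [sq_nonneg ‖besselOp d c‖]
  have hK := entryBound_nonneg hA
  have key : α / 16 * ‖besselOp d c - constOne d‖ ^ 2 ≤
      (α * ∑ j, ‖derivOp η j c‖ ^ 2 + ρ ^ 2 * ‖laplaceOp η c‖ ^ 2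
      - eigenBound hA ρ η * ‖besselOp d c‖ ^ 2) + entryBound hA * ‖η‖ ^ 2 := by
    classical
    refine hasSum_le (fun n => ?_) ((hasSum_norm_sq_repr (fourierBasis d) _).mul_left _)
      ((hasSum_symbol η α ρ (eigenBound hA ρ η) c).add
        (hasSum_ite_eq 0 (entryBound hA * ‖η‖ ^ 2)))
    rw [map_sub, lp.coeFn_sub, Pi.sub_apply, repr_besselOp, repr_constOne]
    -- In the zero mode `ρ²|η|⁴` cancels against `eigenBound`, and the deficit `(α - K)|η|²` is
    -- offset by the added `K|η|²`. In every other mode the part `α/16` of the symbol bound is used,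
    -- which is free of `ρ`.
    by_cases hn : n = 0
    · rw [inner_constOne] at hc1
      have hq : shiftedSq η (0 : Fin d → ℤ) = ‖η‖ ^ 2 := by
        simp [shiftedSq, EuclideanSpace.real_norm_sq_eq]
      simp only [hn, hc1, weight_zero, hq, eigenBound]
      norm_num
      nlinarith [sq_nonneg ‖η‖]
    · have h1 := symbol_lower hα0 hη ρ hn
      have hw := weight_pos n
      have h2 : α / 16 ≤
          α * shiftedSq η n + ρ ^ 2 * shiftedSq η n ^ 2 - eigenBound hA ρ η := by
        have : 0 ≤ ρ ^ 2 / 16 * weight n ^ 2 := by positivity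
        linarith
      simp only [hn, if_false, sub_zero, add_zero, norm_mul, mul_pow, norm_inv, Complex.norm_real,
        Real.norm_of_nonneg hw.le]
      rw [← mul_assoc]
      gcongr
  have h3 : α / 16 * ‖besselOp d c - constOne d‖ ^ 2 ≤ entryBound hA * ‖η‖ ^ 2 := by linarith
  rw [div_mul_eq_mul_div, le_div_iff₀ hα0]
  linarith

end Coercivity

/-! ### The first Bloch eigenfunction -/

section GroundState

variable {d : ℕ} {A : Space d → Matrix (Fin d) (Fin d) ℝ}

local notation "⟪" x ", " y "⟫" => inner ℂ x y

/-- Lowest eigenvectors of the preconditioned Bloch problem, normalized to mean one. -/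
structure IsGroundState (hA : IsAdmissible A) (ρ : ℝ) (η : Space d) (lam : ℝ) (c : CellL2 d) :
    Prop where
  mean : ⟪constOne d, c⟫ = 1
  le_bound : lam ≤ eigenBound hA ρ η
  minimal : ∀ u, lam * (⟪massOp d u, u⟫).re ≤ (⟪blochOp hA ρ η u, u⟫).re
  eigen : blochOp hA ρ η c = (lam : ℂ) • massOp d c

theorem re_inner_massOp_pos {g : CellL2 d} (hg : g ≠ 0) : 0 < (⟪massOp d g, g⟫).re := by
  rw [re_inner_massOp]
  have : besselOp d g ≠ 0 := fun h => hg (besselOp_injective (h.trans (map_zero _).symm))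
  positivity

theorem re_inner_of_eigen {hA : IsAdmissible A} {ρ : ℝ} {η : Space d} {μ : ℝ} {g : CellL2 d}
    (hg : blochOp hA ρ η g = (μ : ℂ) • massOp d g) :
    (⟪blochOp hA ρ η g, g⟫).re = μ * (⟪massOp d g, g⟫).re := by
  rw [hg, inner_smul_left, Complex.conj_ofReal, Complex.re_ofReal_mul]

theorem IsGroundState.le_of_eigen {hA : IsAdmissible A} {ρ : ℝ} {η : Space d} {lam μ : ℝ}
    {c g : CellL2 d} (hc : IsGroundState hA ρ η lam c) (hg0 : g ≠ 0)
    (hg : blochOp hA ρ η g = (μ : ℂ) • massOp d g) : lam ≤ μ := by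
  have h1 := hc.minimal g
  rw [re_inner_of_eigen hg] at h1
  exact le_of_mul_le_mul_right h1 (re_inner_massOp_pos hg0)

theorem IsGroundState.ne_zero {hA : IsAdmissible A} {ρ : ℝ} {η : Space d} {lam : ℝ}
    {c : CellL2 d} (hc : IsGroundState hA ρ η lam c) : c ≠ 0 := by
  rintro rfl
  simpa using hc.mean

/-- `besselOp` fixes the zero mode, which is `1`, and Cauchy–Schwarz with the unit vector `constOne`
applies. -/
theorem IsGroundState.one_le {hA : IsAdmissible A} {ρ : ℝ} {η : Space d} {lam : ℝ}
    {c : CellL2 d} (hc : IsGroundState hA ρ η lam c) : 1 ≤ (⟪massOp d c, c⟫).re := by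
  have h1 : ⟪constOne d, besselOp d c⟫ = 1 := by
    have h2 := hc.mean
    rw [inner_constOne] at h2 ⊢
    rw [repr_besselOp, weight_zero, h2]
    simp
  have h3 := norm_inner_le_norm (𝕜 := ℂ) (constOne d) (besselOp d c)
  rw [h1, norm_constOne, one_mul, norm_one] at h3
  rw [re_inner_massOp]
  nlinarith

theorem re_inner_blochOp_nonneg (hA : IsAdmissible A) (ρ : ℝ) (η : Space d) (u : CellL2 d) :
    0 ≤ (⟪blochOp hA ρ η u, u⟫).re := by
  obtain ⟨α, hα0, hα⟩ := hA.elliptic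
  refine le_trans ?_ (le_re_inner_blochOp hA hα ρ η u)
  have : 0 ≤ ∑ j, ‖derivOp η j u‖ ^ 2 := Finset.sum_nonneg fun j _ => sq_nonneg _
  positivity

theorem IsGroundState.nonneg {hA : IsAdmissible A} {ρ : ℝ} {η : Space d} {lam : ℝ}
    {c : CellL2 d} (hc : IsGroundState hA ρ η lam c) : 0 ≤ lam := by
  have h1 := re_inner_blochOp_nonneg hA ρ η c
  rw [re_inner_of_eigen hc.eigen] at h1
  exact nonneg_of_mul_nonneg_left h1 (re_inner_massOp_pos hc.ne_zero)

/-- First Bloch eigenfunctions have the eigenvalue of the ground state. -/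
theorem IsGroundState.eigen_of_isFirstBlochEigenfunction {hA : IsAdmissible A} {ρ : ℝ}
    {η : Space d} {lam : ℝ} {c g : CellL2 d} {ψ : Space d → ℂ}
    (hc : IsGroundState hA ρ η lam c) (hψ : IsFirstBlochEigenfunction A ρ η ψ)
    (hg : Represents g ψ) : g ≠ 0 ∧ blochOp hA ρ η g = (lam : ℂ) • massOp d g := by
  obtain ⟨μ, hμ, hmin⟩ := hψ
  obtain ⟨hg0, hgμ⟩ := (hg.isBlochEigenpair_iff hA).mp hμ
  obtain ⟨u, hu⟩ := exists_represents_of_cellL2 c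
  have h1 : μ ≤ lam := hmin lam u ((hu.isBlochEigenpair_iff hA).mpr ⟨hc.ne_zero, hc.eigen⟩)
  have h2 : lam ≤ μ := hc.le_of_eigen hg0 hgμ
  rw [le_antisymm h2 h1]
  exact ⟨hg0, hgμ⟩

section Small

variable {hA : IsAdmissible A} {α : ℝ} (hα0 : 0 < α)
  (hα : ∀ᵐ y : Space d, ∀ ξ : Space d, α * ‖ξ‖ ^ 2 ≤ ∑ j, ∑ k, A y j k * ξ k * ξ j)
  {η : Space d} (hη : IsSmall hA α η) {ρ : ℝ} (hρ : 0 < ρ)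

include hα0 hα hη

theorem coercive_sub {lam : ℝ} (hlam : lam ≤ eigenBound hA ρ η) {w : CellL2 d}
    (hw : ⟪constOne d, w⟫ = 0) :
    ρ ^ 2 / 16 * ‖w‖ ^ 2 ≤ (⟪(blochOp hA ρ η - (lam : ℂ) • massOp d) w, w⟫).re := by
  have h1 := coercive_blochOp hα0 hα hη ρ hw
  have h2 : lam * (⟪massOp d w, w⟫).re ≤ eigenBound hA ρ η * (⟪massOp d w, w⟫).re := by
    gcongr
    rw [re_inner_massOp]
    positivity
  rw [sub_apply, smul_apply, inner_sub_left, inner_smul_left, Complex.conj_ofReal, Complex.sub_re,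
    Complex.re_ofReal_mul]
  linarith

include hρ

theorem exists_isGroundState : ∃ lam c, IsGroundState hA ρ η lam c := by
  have hNe : (⟪massOp d (constOne d), constOne d⟫).re = 1 := by
    rw [re_inner_massOp, besselOp_constOne, norm_constOne, one_pow]
  obtain ⟨lam, h1, h2, c, h3, h4⟩ := exists_lowest_eigenvector (isSelfAdjoint_blochOp hA ρ η)
    isSelfAdjoint_massOp (re_inner_blochOp_nonneg hA ρ η)
    (fun u => by rw [re_inner_massOp]; positivity) norm_constOne
    (γ := ρ ^ 2 / 16) (Λ := eigenBound hA ρ η) (by positivity)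
    (fun w hw => coercive_blochOp hα0 hα hη ρ hw) (by rw [hNe]; exact one_pos)
    (by rw [hNe, mul_one]; exact re_inner_blochOp_constOne_le hA ρ η)
  exact ⟨lam, c, h3, h1, h2, h4⟩

/-- Subtracting the multiple of `c` with the same mean leaves a kernel element in the hyperplane on
which the operator is coercive, hence zero. This is simplicity of the eigenvalue. -/
theorem eq_smul_of_eigen {lam : ℝ} {c g : CellL2 d} (hc : IsGroundState hA ρ η lam c)
    (hg : blochOp hA ρ η g = (lam : ℂ) • massOp d g) : g = ⟪constOne d, g⟫ • c := by
  set w := g - ⟪constOne d, g⟫ • c with hw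
  have hw0 : ⟪constOne d, w⟫ = 0 := by
    rw [hw, inner_sub_right, inner_smul_right, hc.mean, mul_one, sub_self]
  have h1 := coercive_sub hα0 hα hη hc.le_bound hw0
  have h2 : (blochOp hA ρ η - (lam : ℂ) • massOp d) w = 0 := by
    rw [sub_apply, smul_apply, hw, map_sub, map_sub, map_smul, map_smul, hg, hc.eigen, smul_sub,
      smul_comm (lam : ℂ), sub_self]
  rw [h2, inner_zero_left, Complex.zero_re] at h1
  have h3 : ‖w‖ = 0 := by
    have : ‖w‖ ^ 2 ≤ 0 := nonpos_of_mul_nonpos_right h1 (by positivity)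
    nlinarith [norm_nonneg w]
  exact sub_eq_zero.mp (norm_eq_zero.mp h3)

end Small

/-- The normalization constant `(2π)^{-d/2}`. -/
def normConst (d : ℕ) : ℝ := (2 * Real.pi) ^ (-(d : ℝ) / 2)

theorem normConst_pos : 0 < normConst d := Real.rpow_pos_of_pos (by positivity) _

/-- The weight of the zero mode is `1`, so preconditioning preserves means, and the normalization is
the linear condition used for ground states. -/
theorem Represents.inner_constOne {g : CellL2 d} {u : Space d → ℂ} (hu : Represents g u) :
    ⟪constOne d, g⟫ = ⨍ y in cell d, u y := by
  rw [BlochHomogenization.inner_constOne, hu.2, weight_zero, Complex.ofReal_one, one_mul,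
    fourierCoeffPer]
  simp

/-- `constOne` is defined as a basis vector, which makes its coefficients evident; here it is
identified with the class of the actual constant function. -/
theorem toLp_const_one : (memL2per_const (d := d) 1).toLp = constOne d := by
  refine (cellL2EquivTorus d).injective ?_
  have h1 : cellL2EquivTorus d (constOne d) = UnitAddTorus.mFourierLp 2 (0 : Fin d → ℤ) := by
    classical
    have h2 : UnitAddTorus.mFourierBasis.repr (cellL2EquivTorus d (constOne d)) =
        lp.single 2 (0 : Fin d → ℤ) (1 : ℂ) := (fourierBasis d).repr_self 0
    have h3 : UnitAddTorus.mFourierBasis.repr (UnitAddTorus.mFourierLp 2 (0 : Fin d → ℤ)) =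
        lp.single 2 (0 : Fin d → ℤ) (1 : ℂ) := by
      rw [← UnitAddTorus.coe_mFourierBasis]
      exact UnitAddTorus.mFourierBasis.repr_self 0
    exact UnitAddTorus.mFourierBasis.repr.injective (h2.trans h3.symm)
  rw [h1]
  refine Lp.ext ?_
  have h2 : cellL2EquivTorus d (memL2per_const (d := d) 1).toLp =ᵐ[torusMeasure d]
      fun _ => (1 : ℂ) := by
    refine (Lp.coeFn_compMeasurePreserving _ measurePreserving_torusSection).trans ?_
    exact measurePreserving_torusSection.quasiMeasurePreserving.ae_eq_comp
      (memL2per_const (d := d) 1).coeFn_toLp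
  refine h2.trans (EventuallyEq.trans ?_ (UnitAddTorus.coeFn_mFourierLp 2 0).symm)
  exact Eventually.of_forall fun x => by simp [UnitAddTorus.mFourier_zero]

section Small

variable {hA : IsAdmissible A} {α : ℝ} (hα0 : 0 < α)
  (hα : ∀ᵐ y : Space d, ∀ ξ : Space d, α * ‖ξ‖ ^ 2 ≤ ∑ j, ∑ k, A y j k * ξ k * ξ j)
  {η : Space d} (hη : IsSmall hA α η) {ρ : ℝ} (hρ : 0 < ρ)

theorem IsGroundState.isNormalizedFirstBloch {lam : ℝ} {c : CellL2 d} {u : Space d → ℂ}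
    (hc : IsGroundState hA ρ η lam c) (hu : Represents ((normConst d : ℂ) • c) u) :
    IsNormalizedFirstBloch A ρ η u := by
  refine ⟨⟨lam, (hu.isBlochEigenpair_iff hA).mpr ⟨?_, ?_⟩, fun μ ψ hψ => ?_⟩, ?_⟩
  · exact smul_ne_zero (by exact_mod_cast normConst_pos.ne') hc.ne_zero
  · rw [map_smul, map_smul, hc.eigen, smul_comm]
  · obtain ⟨g, hg⟩ := hψ.1.exists_represents
    obtain ⟨h1, h2⟩ := (hg.isBlochEigenpair_iff hA).mp hψ
    exact hc.le_of_eigen h1 h2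
  · rw [← hu.inner_constOne, inner_smul_right, hc.mean, mul_one, normConst]

include hα0 hα hη hρ

/-- By simplicity, any prescribed normalized eigenfunction comes from the ground state, so estimates
on ground states apply to arbitrary given families. -/
theorem IsNormalizedFirstBloch.exists_groundState {φ : Space d → ℂ}
    (hφ : IsNormalizedFirstBloch A ρ η φ) :
    ∃ lam c, IsGroundState hA ρ η lam c ∧ Represents ((normConst d : ℂ) • c) φ := by
  obtain ⟨lam, c, hc⟩ := exists_isGroundState hα0 hα hη hρ
  obtain ⟨μ, hμ, hmin⟩ := id hφ.1
  obtain ⟨g, hg⟩ := hμ.1.exists_represents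
  obtain ⟨hg0, hg1⟩ := hc.eigen_of_isFirstBlochEigenfunction hφ.1 hg
  have h1 := eq_smul_of_eigen hα0 hα hη hρ hc hg1
  rw [hg.inner_constOne, hφ.2] at h1
  refine ⟨lam, c, hc, ?_⟩
  rw [normConst, ← h1]
  exact hg

theorem exists_isNormalizedFirstBloch :
    ∃ φ : Space d → ℂ, IsNormalizedFirstBloch A ρ η φ ∧
      ∀ ψ : Space d → ℂ, IsFirstBlochEigenfunction A ρ η ψ →
        ∃ c : ℂ, ψ =ᵐ[volume] fun y => c * φ y := by
  obtain ⟨lam, c, hc⟩ := exists_isGroundState hα0 hα hη hρ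
  obtain ⟨φ, hφ⟩ := exists_represents_of_cellL2 ((normConst d : ℂ) • c)
  refine ⟨φ, hc.isNormalizedFirstBloch hφ, fun ψ hψ => ?_⟩
  obtain ⟨μ, hμ, hmin⟩ := id hψ
  obtain ⟨g, hg⟩ := hμ.1.exists_represents
  obtain ⟨hg0, hg1⟩ := hc.eigen_of_isFirstBlochEigenfunction hψ hg
  have h1 := eq_smul_of_eigen hα0 hα hη hρ hc hg1
  refine ⟨⟪constOne d, g⟫ * (normConst d : ℂ)⁻¹, ?_⟩
  rw [hg.ae_eq_iff (hφ.const_mul _), smul_smul, mul_assoc, inv_mul_cancel₀, mul_one]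
  · exact h1
  · exact_mod_cast normConst_pos.ne'

/-- The first Bloch eigenfunction is close to a constant for small quasimomentum, uniformly
in `ρ`. -/
theorem IsNormalizedFirstBloch.eLpNorm_sub_const_le {φ : Space d → ℂ}
    (hφ : IsNormalizedFirstBloch A ρ η φ) :
    MemL2per (fun y => φ y + -(normConst d : ℂ)) ∧
      eLpNorm (fun y => φ y + -(normConst d : ℂ)) 2 (cellMeasure d) ≤
        ENNReal.ofReal (normConst d * Real.sqrt (16 * entryBound hA / α) * ‖η‖) := by
  obtain ⟨lam, c, hc, hrep⟩ := hφ.exists_groundState hα0 hα hη hρ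
  have hmem := hrep.1.1.add (memL2per_const (-(normConst d : ℂ)))
  refine ⟨hmem, ?_⟩
  have h1 : hmem.toLp = (normConst d : ℂ) • (besselOp d c - constOne d) := by
    rw [hrep.1.1.toLp_add (memL2per_const _), hrep.toLp_eq, map_smul, smul_sub, sub_eq_add_neg,
      ← toLp_const_one, ← smul_neg]
    congr 1
    rw [smul_neg, ← neg_smul, ← MemL2per.toLp_const_mul]
    simp only [mul_one]
  have h2 := norm_besselOp_sub_const_le hα0 hα hη hc.le_bound hc.mean hc.eigen
  have h3 : ‖besselOp d c - constOne d‖ ≤ Real.sqrt (16 * entryBound hA / α) * ‖η‖ := by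
    rw [← Real.sqrt_sq (norm_nonneg η), ← Real.sqrt_mul
      (div_nonneg (mul_nonneg (by norm_num) (entryBound_nonneg hA)) hα0.le)]
    exact Real.le_sqrt_of_sq_le h2
  have h4 : ‖hmem.toLp‖ ≤ normConst d * Real.sqrt (16 * entryBound hA / α) * ‖η‖ := by
    rw [h1, norm_smul, Complex.norm_real, Real.norm_of_nonneg normConst_pos.le, mul_assoc]
    exact mul_le_mul_of_nonneg_left h3 normConst_pos.le
  rw [MemL2per.toLp, Lp.norm_toLp] at h4
  rw [← ENNReal.ofReal_toReal hmem.memLp.eLpNorm_ne_top]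
  exact ENNReal.ofReal_le_ofReal h4

end Small

theorem IsSmall.eigenBound_le {hA : IsAdmissible A} {α : ℝ} {η : Space d} (hη : IsSmall hA α η)
    (ρ : ℝ) : eigenBound hA ρ η ≤ ρ ^ 2 + α / 2 := by
  have h1 := hη.norm_sq_le
  have h2 := hη.bound_le
  have h3 : (‖η‖ ^ 2) ^ 2 ≤ 1 := pow_le_one₀ (by positivity) (by linarith)
  unfold eigenBound
  nlinarith [sq_nonneg ρ]

/-- Lipschitz dependence of the ground state on the operator. -/
theorem exists_norm_groundState_sub_le (hA : IsAdmissible A) {α : ℝ} (hα0 : 0 < α)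
    (hα : ∀ᵐ y : Space d, ∀ ξ : Space d, α * ‖ξ‖ ^ 2 ≤ ∑ j, ∑ k, A y j k * ξ k * ξ j)
    {ρ : ℝ} (hρ : 0 < ρ) :
    ∃ C : ℝ, ∀ η η', IsSmall hA α η → IsSmall hA α η' → ∀ lam c lam' c',
      IsGroundState hA ρ η lam c → IsGroundState hA ρ η' lam' c' →
      ‖c - c'‖ ≤ ‖blochOp hA ρ η - blochOp hA ρ η'‖ * C := by
  -- Small quasimomenta lie in the unit ball, where `blochOp` is bounded at fixed `ρ`. The resulting
  -- constants depend on `ρ`; this is harmless, as the estimate serves only continuity in `η`.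
  obtain ⟨B, hB⟩ := (isCompact_closedBall (0 : Space d) 1).exists_bound_of_continuousOn
    (continuous_blochOp hA ρ).continuousOn
  set R : ℝ := 1 + (B + (ρ ^ 2 + α / 2)) / (ρ ^ 2 / 16) with hR
  have key : ∀ η, IsSmall hA α η → ∀ lam c, IsGroundState hA ρ η lam c → ‖c‖ ≤ R :=
    fun η hη lam c hc => by
      have hη1 : η ∈ Metric.closedBall (0 : Space d) 1 := by
        rw [mem_closedBall_zero_iff]
        nlinarith [hη.norm_sq_le, norm_nonneg η]
      refine (norm_lowest_eigenvector_le norm_constOne (γ := ρ ^ 2 / 16) (by positivity)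
        (fun w hw => coercive_sub hα0 hα hη hc.le_bound hw) hc.mean hc.eigen).trans ?_
      rw [hR]
      gcongr
      refine (norm_sub_le _ _).trans (add_le_add (hB η hη1) ?_)
      rw [norm_smul, Complex.norm_real, Real.norm_of_nonneg hc.nonneg]
      exact (mul_le_of_le_one_right hc.nonneg norm_massOp_le).trans
        (hc.le_bound.trans (hη.eigenBound_le ρ))
  refine ⟨(1 + R ^ 2) * R / (ρ ^ 2 / 16), fun η η' hη hη' lam c lam' c' hc hc' => ?_⟩
  exact norm_lowest_eigenvector_sub_le (by positivity) norm_massOp_le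
    (fun w hw => coercive_sub hα0 hα hη hc.le_bound hw) hc.minimal hc'.minimal hc.mean hc'.mean
    hc.eigen hc'.eigen hc.one_le hc'.one_le (key η hη lam c hc) (key η' hη' lam' c' hc')

/-- The normalized first Bloch eigenfunction depends continuously on the quasimomentum. -/
theorem tendsto_eLpNorm_sub (hA : IsAdmissible A) {α : ℝ} (hα0 : 0 < α)
    (hα : ∀ᵐ y : Space d, ∀ ξ : Space d, α * ‖ξ‖ ^ 2 ≤ ∑ j, ∑ k, A y j k * ξ k * ξ j)
    {ρ : ℝ} (hρ : 0 < ρ) {Φ : Space d → Space d → ℂ} {U : Set (Space d)} (hU : IsOpen U)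
    (hsmall : ∀ η ∈ U, IsSmall hA α η) (hΦ : ∀ η ∈ U, IsNormalizedFirstBloch A ρ η (Φ η))
    {η₀ : Space d} (hη₀ : η₀ ∈ U) :
    Tendsto (fun η => eLpNorm (fun y => Φ η y + -1 * Φ η₀ y) 2 (cellMeasure d)) (𝓝 η₀) (𝓝 0) := by
  obtain ⟨C, hC⟩ := exists_norm_groundState_sub_le hA hα0 hα hρ
  have hlim : Tendsto (fun η => ENNReal.ofReal
      (normConst d * (‖blochOp hA ρ η - blochOp hA ρ η₀‖ * C))) (𝓝 η₀) (𝓝 0) := by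
    have h1 : Continuous fun η =>
        normConst d * (‖blochOp hA ρ η - blochOp hA ρ η₀‖ * C) := by
      have := continuous_blochOp hA ρ
      fun_prop
    have h2 := (ENNReal.continuous_ofReal.comp h1).tendsto η₀
    simpa [Function.comp_def] using h2
  refine tendsto_of_tendsto_of_tendsto_of_le_of_le' tendsto_const_nhds hlim
    (Eventually.of_forall fun _ => zero_le) ?_
  filter_upwards [hU.mem_nhds hη₀] with η hη
  obtain ⟨lam, c, hc, hrep⟩ := (hΦ η hη).exists_groundState hα0 hα (hsmall η hη) hρ
  obtain ⟨lam', c', hc', hrep'⟩ := (hΦ η₀ hη₀).exists_groundState hα0 hα (hsmall η₀ hη₀) hρ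
  have hmem := hrep.1.1.add (hrep'.1.1.const_mul (-1))
  have h1 : hmem.toLp = (normConst d : ℂ) • besselOp d (c - c') := by
    rw [hrep.1.1.toLp_add (hrep'.1.1.const_mul (-1)), hrep'.1.1.toLp_const_mul, hrep.toLp_eq,
      hrep'.toLp_eq, map_smul, map_smul, map_sub, smul_sub, neg_one_smul, sub_eq_add_neg]
  have h2 : ‖hmem.toLp‖ ≤ normConst d * (‖blochOp hA ρ η - blochOp hA ρ η₀‖ * C) := by
    rw [h1, norm_smul, Complex.norm_real, Real.norm_of_nonneg normConst_pos.le]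
    refine mul_le_mul_of_nonneg_left ?_ normConst_pos.le
    refine le_trans ?_ (hC η η₀ (hsmall η hη) (hsmall η₀ hη₀) lam c lam' c' hc hc')
    refine ((besselOp d).le_opNorm _).trans (mul_le_of_le_one_left (norm_nonneg _) ?_)
    exact norm_multiplier_le _ _ _
  rw [MemL2per.toLp, Lp.norm_toLp] at h2
  rw [← ENNReal.ofReal_toReal hmem.memLp.eLpNorm_ne_top]
  exact ENNReal.ofReal_le_ofReal h2

theorem exists_isSmall (hA : IsAdmissible A) {α : ℝ} (hα0 : 0 < α) :
    ∃ δ₀ > 0, ∀ η : Space d, ‖η‖ < δ₀ → IsSmall hA α η := by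
  have hK := entryBound_nonneg hA
  refine ⟨min (1 / 4) (Real.sqrt (α / (2 * (entryBound hA + 1)))),
    lt_min (by norm_num) (Real.sqrt_pos.mpr (by positivity)), fun η hη => ⟨?_, ?_⟩⟩
  · have := hη.trans_le (min_le_left _ _)
    nlinarith [norm_nonneg η]
  · have h1 := hη.trans_le (min_le_right _ _)
    rw [Real.lt_sqrt (norm_nonneg η), lt_div_iff₀ (by positivity)] at h1
    nlinarith [sq_nonneg ‖η‖]

end GroundState

/-! ### The Bloch transform -/

section Transform

variable {d : ℕ}

/-- The plane wave `e^{-i x·ξ}`. -/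
def planeWave (ξ x : Space d) : ℂ := Complex.exp (-Complex.I * ((inner ℝ x ξ : ℝ) : ℂ))

theorem norm_planeWave (ξ x : Space d) : ‖planeWave ξ x‖ = 1 := by
  have : -Complex.I * ((inner ℝ x ξ : ℝ) : ℂ) = ((-inner ℝ x ξ : ℝ) : ℂ) * Complex.I := by
    push_cast; ring
  rw [planeWave, this, Complex.norm_exp_ofReal_mul_I]

theorem continuous_planeWave (ξ : Space d) : Continuous (planeWave ξ) := by
  unfold planeWave; fun_prop

theorem continuous_planeWave_left (x : Space d) : Continuous fun ξ => planeWave ξ x := by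
  unfold planeWave; fun_prop

/-- The pairing of `g` with a modulated periodic profile `w` at scale `ε`. -/
def pairing (g : Space d → ℂ) (ε : ℝ) (ξ : Space d) (w : Space d → ℂ) : ℂ :=
  ∫ x, g x * planeWave ξ x * conj (w (ε⁻¹ • x))

theorem blochTransform_eq_pairing (φ : ℝ → Space d → Space d → ℂ) (κ ε : ℝ) (g : Space d → ℂ)
    (ξ : Space d) : blochTransform φ κ ε g ξ = pairing g ε ξ (φ (κ / ε) (ε • ξ)) := rfl

/-! ### Integrals against modulated oscillating profiles -/

section Pairing

variable {g : Space d → ℂ} (hg : MemLp g 2 volume) {R ε : ℝ} (hR : 0 ≤ R) (hε : 0 < ε)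
  (hsupp : ∀ᵐ x, x ∉ Metric.closedBall (0 : Space d) R → g x = 0)

/-- The growth factor of the `L²` norm of a periodic profile over a ball of radius `R`. -/
def ballFactor (d : ℕ) (R ε : ℝ) : ℝ := Real.sqrt ((2 * R + 4 * Real.pi * ε) ^ d)

include hε in
theorem MemL2per.aestronglyMeasurable_scaled {w : Space d → ℂ} (hw : MemL2per w) :
    AEStronglyMeasurable (fun x => w (ε⁻¹ • x)) volume := by
  refine hw.aestronglyMeasurable.comp_quasiMeasurePreserving
    ⟨measurable_const_smul _, ?_⟩
  rw [Measure.map_addHaar_smul _ (inv_ne_zero hε.ne')]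
  exact Measure.smul_absolutelyContinuous

include hg hR hε

theorem memLp_integrand {w : Space d → ℂ} (hw : MemL2per w) :
    MemLp (fun x => g x * w (ε⁻¹ • x)) 1 (volume.restrict (Metric.closedBall 0 R)) ∧
    eLpNorm (fun x => g x * w (ε⁻¹ • x)) 1 (volume.restrict (Metric.closedBall 0 R)) ≤
      eLpNorm g 2 volume * (ENNReal.ofReal (ballFactor d R ε) *
        eLpNorm w 2 (cellMeasure d)) := by
  have hwm := (hw.aestronglyMeasurable_scaled hε).restrict (s := Metric.closedBall (0 : Space d) R)
  have h1 := eLpNorm_closedBall_scaled_le hw.1 hR hε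
  have hgr := hg.restrict (Metric.closedBall (0 : Space d) R)
  have hle : eLpNorm (fun x => g x * w (ε⁻¹ • x)) 1 (volume.restrict (Metric.closedBall 0 R)) ≤
      eLpNorm g 2 volume * (ENNReal.ofReal (ballFactor d R ε) *
        eLpNorm w 2 (cellMeasure d)) :=
    (eLpNorm_smul_le_mul_eLpNorm (p := 2) (q := 2) (r := 1) hwm hgr.1).trans
      (mul_le_mul' (eLpNorm_mono_measure _ Measure.restrict_le_self) h1)
  exact ⟨⟨hgr.1.mul hwm, hle.trans_lt (ENNReal.mul_lt_top hg.eLpNorm_lt_top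
    (ENNReal.mul_lt_top ENNReal.ofReal_lt_top hw.memLp.eLpNorm_lt_top))⟩, hle⟩

include hsupp

theorem integrable_mul_scaled {w : Space d → ℂ} (hw : MemL2per w) :
    Integrable (fun x => g x * w (ε⁻¹ • x)) volume := by
  have h1 := memLp_one_iff_integrable.mp (memLp_integrand hg hR hε hw).1
  have h2 : IntegrableOn (fun x => g x * w (ε⁻¹ • x)) (Metric.closedBall 0 R) := h1
  rw [← integrable_indicator_iff Metric.isClosed_closedBall.measurableSet] at h2
  refine h2.congr ?_
  filter_upwards [hsupp] with x hx
  by_cases hxK : x ∈ Metric.closedBall (0 : Space d) R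
  · rw [Set.indicator_of_mem hxK]
  · rw [Set.indicator_of_notMem hxK, hx hxK, zero_mul]

theorem integrable_pairing {w : Space d → ℂ} (hw : MemL2per w) (ξ : Space d) :
    Integrable (fun x => g x * planeWave ξ x * conj (w (ε⁻¹ • x))) volume := by
  have h1 := integrable_mul_scaled hg hR hε hsupp hw
  refine h1.norm.mono' ?_ (Eventually.of_forall fun x => ?_)
  · exact (hg.1.mul (continuous_planeWave ξ).aestronglyMeasurable).mul
      (Complex.continuous_conj.comp_aestronglyMeasurable (hw.aestronglyMeasurable_scaled hε))
  · simp [norm_planeWave]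

/-- Hölder's inequality on the ball carrying `g`, where the oscillating profile is controlled by
counting cells. Modulation does not change absolute values, so the bound is uniform in `ξ`. -/
theorem enorm_pairing_le {w : Space d → ℂ} (hw : MemL2per w) (ξ : Space d) :
    ‖pairing g ε ξ w‖ₑ ≤ eLpNorm g 2 volume * (ENNReal.ofReal (ballFactor d R ε) *
      eLpNorm w 2 (cellMeasure d)) := by
  refine le_trans ?_ (memLp_integrand hg hR hε hw).2
  have h1 : pairing g ε ξ w =
      ∫ x in Metric.closedBall 0 R, g x * planeWave ξ x * conj (w (ε⁻¹ • x)) := by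
    refine (setIntegral_eq_integral_of_ae_compl_eq_zero ?_).symm
    filter_upwards [hsupp] with x hx hxK
    rw [hx hxK, zero_mul, zero_mul]
  rw [h1, eLpNorm_one_eq_lintegral_enorm]
  refine (enorm_integral_le_lintegral_enorm _).trans (lintegral_mono fun x => le_of_eq ?_)
  rw [← ofReal_norm, ← ofReal_norm]
  congr 1
  simp [norm_planeWave]

theorem pairing_add {w w' : Space d → ℂ} (hw : MemL2per w) (hw' : MemL2per w') (ξ : Space d) :
    pairing g ε ξ (fun y => w y + w' y) = pairing g ε ξ w + pairing g ε ξ w' := by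
  rw [pairing, pairing, pairing, ← integral_add (integrable_pairing hg hR hε hsupp hw ξ)
    (integrable_pairing hg hR hε hsupp hw' ξ)]
  simp only [map_add, mul_add]

theorem continuous_pairing {w : Space d → ℂ} (hw : MemL2per w) :
    Continuous fun ξ => pairing g ε ξ w := by
  refine continuous_of_dominated (fun ξ => (integrable_pairing hg hR hε hsupp hw ξ).1)
    (fun ξ => Eventually.of_forall fun x => ?_)
    (integrable_mul_scaled hg hR hε hsupp hw).norm (Eventually.of_forall fun x => ?_)
  · simp [norm_planeWave]
  · have := continuous_planeWave_left x
    fun_prop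

/-- Continuity in `ξ` of the pairing with profiles that depend continuously on `ξ` in `L²`. -/
theorem continuousAt_pairing {Φ : Space d → Space d → ℂ} {ξ₀ : Space d}
    (hΦ : ∀ᶠ ξ in 𝓝 ξ₀, MemL2per (Φ ξ))
    (hlim : Tendsto (fun ξ => eLpNorm (fun y => Φ ξ y + -1 * Φ ξ₀ y) 2 (cellMeasure d))
      (𝓝 ξ₀) (𝓝 0)) :
    ContinuousAt (fun ξ => pairing g ε ξ (Φ ξ)) ξ₀ := by
  have h0 : MemL2per (Φ ξ₀) := hΦ.self_of_nhds
  -- The change of profile is separated from the change of plane wave; the former is small by the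
  -- uniform bound, the latter by `continuous_pairing`.
  have h1 : Tendsto (fun ξ => pairing g ε ξ (fun y => Φ ξ y + -1 * Φ ξ₀ y)) (𝓝 ξ₀) (𝓝 0) := by
    rw [tendsto_zero_iff_enorm_tendsto_zero]
    have h2 : Tendsto (fun ξ => eLpNorm g 2 volume * (ENNReal.ofReal (ballFactor d R ε) *
        eLpNorm (fun y => Φ ξ y + -1 * Φ ξ₀ y) 2 (cellMeasure d))) (𝓝 ξ₀) (𝓝 0) := by
      have := ENNReal.Tendsto.const_mul (a := eLpNorm g 2 volume) (ENNReal.Tendsto.const_mul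
        (a := ENNReal.ofReal (ballFactor d R ε)) hlim (Or.inr ENNReal.ofReal_ne_top))
        (Or.inr hg.eLpNorm_ne_top)
      simpa using this
    refine tendsto_of_tendsto_of_tendsto_of_le_of_le' tendsto_const_nhds h2
      (Eventually.of_forall fun _ => zero_le) ?_
    filter_upwards [hΦ] with ξ hξ
    exact enorm_pairing_le hg hR hε hsupp (hξ.add (h0.const_mul (-1))) ξ
  have h3 := h1.add ((continuous_pairing hg hR hε hsupp h0).tendsto ξ₀)
  rw [zero_add] at h3
  refine h3.congr' ?_
  filter_upwards [hΦ] with ξ hξ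
  rw [← pairing_add hg hR hε hsupp (hξ.add (h0.const_mul (-1))) h0]
  congr 1
  ext y
  ring

end Pairing

/-- A weakly convergent sequence in `L²` is bounded. -/
theorem exists_eLpNorm_le_of_tendstoWeakL2 {g : ℕ → Space d → ℂ} {g₀ : Space d → ℂ}
    (hg : ∀ n, MemLp (g n) 2 volume) (h : TendstoWeakL2 volume g g₀) :
    ∃ C : ℝ, 0 ≤ C ∧ ∀ n, eLpNorm (g n) 2 volume ≤ ENNReal.ofReal C := by
  have h1 : ∀ x : Lp ℂ 2 (volume : Measure (Space d)),
      ∃ C, ∀ n, ‖innerSL ℂ ((hg n).toLp (g n)) x‖ ≤ C := fun x => by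
    have h2 := (h.2.2 x (Lp.memLp x)).norm
    obtain ⟨C, hC⟩ := h2.bddAbove_range
    refine ⟨C, fun n => ?_⟩
    rw [innerSL_apply_apply, ← norm_inner_symm, L2.inner_def]
    refine le_of_eq_of_le (congrArg norm (integral_congr_ae ?_)) (hC ⟨n, rfl⟩)
    filter_upwards [(hg n).coeFn_toLp] with y hy
    rw [hy, RCLike.inner_apply]
  obtain ⟨C, hC⟩ := banach_steinhaus h1
  refine ⟨|C|, abs_nonneg _, fun n => ?_⟩
  have h2 := (hC n).trans (le_abs_self C)
  rw [innerSL_apply_norm, Lp.norm_toLp] at h2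
  rw [← ENNReal.ofReal_toReal (hg n).eLpNorm_ne_top]
  exact ENNReal.ofReal_le_ofReal h2

/-- Pointwise convergence of the Fourier integrals of a weakly convergent sequence of functions
with supports in a common compact set. -/
theorem tendsto_integral_planeWave {g : ℕ → Space d → ℂ} {g₀ : Space d → ℂ} {K : Set (Space d)}
    (hK : IsCompact K) (hsupp : ∀ n, ∀ᵐ x, x ∉ K → g n x = 0) (h : TendstoWeakL2 volume g g₀)
    (ξ : Space d) :
    Tendsto (fun n => ∫ x, g n x * planeWave ξ x) atTop (𝓝 (∫ x, g₀ x * planeWave ξ x)) := by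
  have hKm := hK.isClosed.measurableSet
  -- The weak limit is also supported in `K`: testing with its own restriction to the complement of
  -- `K` shows that this restriction has norm zero.
  have hzero : ∀ᵐ x, x ∉ K → g₀ x = 0 := by
    have h1 := h.2.2 (Kᶜ.indicator g₀) (h.2.1.indicator hKm.compl)
    have h2 : ∀ n, ∫ x, g n x * conj (Kᶜ.indicator g₀ x) = 0 := fun n => by
      refine integral_eq_zero_of_ae ?_
      filter_upwards [hsupp n] with x hx
      by_cases hxK : x ∈ K
      · simp [hxK]
      · simp [hx hxK]
    simp only [h2] at h1
    have h3 := tendsto_nhds_unique h1 tendsto_const_nhds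
    have h4 : ∫ x, g₀ x * conj (Kᶜ.indicator g₀ x) =
        ((∫ x, ‖Kᶜ.indicator g₀ x‖ ^ 2 : ℝ) : ℂ) := by
      rw [← integral_complex_ofReal]
      refine integral_congr_ae (Eventually.of_forall fun x => ?_)
      by_cases hxK : x ∈ K
      · simp [hxK]
      · simp [hxK, Complex.mul_conj, Complex.normSq_eq_norm_sq]
    rw [h4] at h3
    have h5 : ∫ x, ‖Kᶜ.indicator g₀ x‖ ^ 2 = 0 := by exact_mod_cast h3
    rw [integral_eq_zero_iff_of_nonneg (fun x => by positivity)
      ((memLp_two_iff_integrable_sq_norm (h.2.1.indicator hKm.compl).1).mp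
        (h.2.1.indicator hKm.compl))] at h5
    filter_upwards [h5] with x hx hxK
    simpa [hxK] using hx
  -- A plane wave is not in `L²`, but its cutoff to `K` is, and the functions supported in `K` do
  -- not see the difference.
  have hψ : MemLp (K.indicator fun x => conj (planeWave ξ x)) 2 volume := by
    rw [memLp_indicator_iff_restrict hKm]
    have : IsFiniteMeasure ((volume : Measure (Space d)).restrict K) :=
      ⟨by rw [Measure.restrict_apply_univ]; exact hK.measure_lt_top⟩
    refine MemLp.of_bound (Complex.continuous_conj.comp
      (continuous_planeWave ξ)).aestronglyMeasurable 1 (Eventually.of_forall fun x => ?_)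
    simp [norm_planeWave]
  have key : ∀ f : Space d → ℂ, (∀ᵐ x, x ∉ K → f x = 0) →
      ∫ x, f x * planeWave ξ x =
        ∫ x, f x * conj (K.indicator (fun x => conj (planeWave ξ x)) x) := fun f hf => by
    refine integral_congr_ae ?_
    filter_upwards [hf] with x hx
    by_cases hxK : x ∈ K
    · simp [hxK]
    · simp [hx hxK]
  rw [key g₀ hzero]
  exact (h.2.2 _ hψ).congr fun n => (key (g n) (hsupp n)).symm

/-- Dominated convergence as weak convergence in `L²` of a finite measure. -/
theorem tendstoWeakL2_of_bounded {μ : Measure (Space d)} [IsFiniteMeasure μ]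
    {F : ℕ → Space d → ℂ} {f : Space d → ℂ} {B : ℝ}
    (hmeas : ∀ᶠ n in atTop, AEStronglyMeasurable (F n) μ)
    (hbound : ∀ᶠ n in atTop, ∀ᵐ x ∂μ, ‖F n x‖ ≤ B)
    (hlim : ∀ᵐ x ∂μ, Tendsto (fun n => F n x) atTop (𝓝 (f x))) : TendstoWeakL2 μ F f := by
  have hf : MemLp f 2 μ := by
    -- Measurability and bounds hold only eventually, so the limit is taken along the tail shifted
    -- by `N`.
    obtain ⟨N, hN⟩ := eventually_atTop.mp (hmeas.and hbound)
    have h1 : AEStronglyMeasurable f μ := by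
      refine aestronglyMeasurable_of_tendsto_ae atTop (f := fun n => F (n + N))
        (fun n => (hN _ (Nat.le_add_left N n)).1) ?_
      filter_upwards [hlim] with x hx
      exact (tendsto_add_atTop_iff_nat (f := fun n => F n x) N).mpr hx
    refine MemLp.of_bound h1 B ?_
    have h2 : ∀ᵐ x ∂μ, ∀ n, ‖F (n + N) x‖ ≤ B :=
      ae_all_iff.mpr fun n => (hN _ (Nat.le_add_left N n)).2
    filter_upwards [hlim, h2] with x hx hx2
    exact le_of_tendsto ((tendsto_add_atTop_iff_nat (f := fun n => F n x) N).mpr hx).norm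
      (Eventually.of_forall hx2)
  refine ⟨?_, hf, fun ψ hψ => ?_⟩
  · filter_upwards [hmeas, hbound] with n h1 h2
    exact MemLp.of_bound h1 B h2
  · refine tendsto_integral_filter_of_dominated_convergence (fun x => B * ‖ψ x‖) ?_ ?_ ?_ ?_
    · filter_upwards [hmeas] with n hn
      exact hn.mul (Complex.continuous_conj.comp_aestronglyMeasurable hψ.1)
    · filter_upwards [hbound] with n hn
      filter_upwards [hn] with x hx
      rw [norm_mul, RCLike.norm_conj]
      gcongr
    · exact (hψ.integrable one_le_two).norm.const_mul B
    · filter_upwards [hlim] with x hx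
      exact hx.mul_const _

end Transform

/-! ### Comparison of the Bloch and Fourier transforms -/

section Convergence

variable {d : ℕ}

theorem norm_pairing_le {g : Space d → ℂ} (hg : MemLp g 2 volume) {R ε C W : ℝ} (hR : 0 ≤ R)
    (hε : 0 < ε) (hsupp : ∀ᵐ x, x ∉ Metric.closedBall (0 : Space d) R → g x = 0) (hC : 0 ≤ C)
    (hW : 0 ≤ W) (hgC : eLpNorm g 2 volume ≤ ENNReal.ofReal C) {w : Space d → ℂ}
    (hw : MemL2per w) (hwW : eLpNorm w 2 (cellMeasure d) ≤ ENNReal.ofReal W) (ξ : Space d) :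
    ‖pairing g ε ξ w‖ ≤ C * (ballFactor d R ε * W) := by
  have hb : 0 ≤ ballFactor d R ε := Real.sqrt_nonneg _
  have h1 := (enorm_pairing_le hg hR hε hsupp hw ξ).trans
    (mul_le_mul' hgC (mul_le_mul' le_rfl hwW))
  rw [← ENNReal.ofReal_mul hb, ← ENNReal.ofReal_mul hC, ← ofReal_norm] at h1
  exact (ENNReal.ofReal_le_ofReal_iff (by positivity)).mp h1

theorem ballFactor_mono {R ε ε' : ℝ} (hR : 0 ≤ R) (hε : 0 < ε) (h : ε ≤ ε') :
    ballFactor d R ε ≤ ballFactor d R ε' := by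
  unfold ballFactor
  gcongr

variable {A : Space d → Matrix (Fin d) (Fin d) ℝ} {hA : IsAdmissible A} {α : ℝ} (hα0 : 0 < α)
  (hα : ∀ᵐ y : Space d, ∀ ξ : Space d, α * ‖ξ‖ ^ 2 ≤ ∑ j, ∑ k, A y j k * ξ k * ξ j)
  {r : ℝ} (hsmall : ∀ η : Space d, ‖η‖ < r → IsSmall hA α η)
  {φ : ℝ → Space d → Space d → ℂ}
  (hφ : ∀ ρ : ℝ, 0 < ρ → ∀ η : Space d, ‖η‖ < r → IsNormalizedFirstBloch A ρ η (φ ρ η))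
  {g : Space d → ℂ} (hg : MemLp g 2 volume) {R ε κ : ℝ} (hR : 0 ≤ R) (hε : 0 < ε) (hκ : 0 < κ)
  (hsupp : ∀ᵐ x, x ∉ Metric.closedBall (0 : Space d) R → g x = 0)

include hα0 hα hsmall hφ hg hR hε hκ hsupp

/-- This is what supplies measurability in `ξ`: no regularity in `η` is assumed of the given family,
but uniqueness of its members forces continuity in `L²`. -/
theorem continuousOn_blochTransform :
    ContinuousOn (blochTransform φ κ ε g) {ξ | ‖ε • ξ‖ < r} := by
  intro ξ hξ
  have hρ : 0 < κ / ε := div_pos hκ hε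
  refine ContinuousAt.continuousWithinAt ?_
  have hscale : Tendsto (fun ξ : Space d => ε • ξ) (𝓝 ξ) (𝓝 (ε • ξ)) :=
    (continuous_const_smul ε).tendsto ξ
  have hU : IsOpen {η : Space d | ‖η‖ < r} := isOpen_lt continuous_norm continuous_const
  refine continuousAt_pairing (Φ := fun ξ => φ (κ / ε) (ε • ξ)) hg hR hε hsupp ?_ ?_
  · filter_upwards [hscale (hU.mem_nhds hξ)] with ξ' hξ'
    obtain ⟨μ, hμ, -⟩ := (hφ _ hρ _ hξ').1
    exact hμ.1.1
  · exact (tendsto_eLpNorm_sub hA hα0 hα hρ hU hsmall (Φ := φ (κ / ε)) (hφ _ hρ) hξ).comp hscale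

/-- The Bloch transform is close to the Fourier transform at small scaled frequencies. -/
theorem norm_blochTransform_sub_le {C : ℝ} (hC : 0 ≤ C)
    (hgC : eLpNorm g 2 volume ≤ ENNReal.ofReal C) {ξ : Space d} (hξ : ‖ε • ξ‖ < r) :
    ‖blochTransform φ κ ε g ξ - normConst d * ∫ x, g x * planeWave ξ x‖ ≤
      C * (ballFactor d R ε *
        (normConst d * Real.sqrt (16 * entryBound hA / α) * ‖ε • ξ‖)) := by
  have hρ : 0 < κ / ε := div_pos hκ hε
  obtain ⟨h1, h2⟩ := (hφ _ hρ _ hξ).eLpNorm_sub_const_le hα0 hα (hsmall _ hξ) hρ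
  have h3 : pairing g ε ξ (fun _ => (normConst d : ℂ)) =
      normConst d * ∫ x, g x * planeWave ξ x := by
    rw [pairing, ← integral_const_mul]
    refine integral_congr_ae (Eventually.of_forall fun x => ?_)
    simp only [Complex.conj_ofReal]
    ring
  have h4 : blochTransform φ κ ε g ξ =
      pairing g ε ξ (fun y => φ (κ / ε) (ε • ξ) y + -(normConst d : ℂ)) +
        pairing g ε ξ (fun _ => (normConst d : ℂ)) := by
    rw [← pairing_add hg hR hε hsupp h1 (memL2per_const _), blochTransform_eq_pairing]
    simp only [neg_add_cancel_right]
  rw [h4, h3, add_sub_cancel_right]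
  refine norm_pairing_le hg hR hε hsupp hC ?_ hgC h1 h2 ξ
  have := normConst_pos (d := d)
  positivity

/-- The profile is a constant plus a deviation of order `r`, both bounded independently of `κ`; this
provides the dominating constant. -/
theorem norm_blochTransform_le {C : ℝ} (hC : 0 ≤ C)
    (hgC : eLpNorm g 2 volume ≤ ENNReal.ofReal C) {ξ : Space d} (hξ : ‖ε • ξ‖ < r) :
    ‖blochTransform φ κ ε g ξ‖ ≤ C * (ballFactor d R ε *
      (normConst d * Real.sqrt (16 * entryBound hA / α) * r + normConst d)) := by
  have hρ : 0 < κ / ε := div_pos hκ hε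
  have hc := normConst_pos (d := d)
  have hr : 0 ≤ r := (norm_nonneg _).trans hξ.le
  obtain ⟨h1, h2⟩ := (hφ _ hρ _ hξ).eLpNorm_sub_const_le hα0 hα (hsmall _ hξ) hρ
  have hmem : MemL2per (φ (κ / ε) (ε • ξ)) := by
    obtain ⟨μ, hμ, -⟩ := (hφ _ hρ _ hξ).1
    exact hμ.1.1
  refine norm_pairing_le hg hR hε hsupp hC (by positivity) hgC hmem ?_ ξ
  have h3 : φ (κ / ε) (ε • ξ) = (fun y => φ (κ / ε) (ε • ξ) y + -(normConst d : ℂ)) +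
      fun _ => (normConst d : ℂ) := by
    ext y
    simp
  rw [h3, ENNReal.ofReal_add (by positivity) hc.le]
  refine (eLpNorm_add_le h1.memLp.1 aestronglyMeasurable_const one_le_two).trans
    (add_le_add (h2.trans (ENNReal.ofReal_le_ofReal ?_)) ?_)
  · gcongr
  · rw [eLpNorm_const _ (by norm_num) (IsProbabilityMeasure.ne_zero _), measure_univ,
      ENNReal.one_rpow, mul_one, ← ofReal_norm, Complex.norm_real, Real.norm_of_nonneg hc.le]

end Convergence

end BlochHomogenization

end

/-! ### The theorem -/

theorem theorem6p2 {d : ℕ}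
    (A : BlochHomogenization.Space d → Matrix (Fin d) (Fin d) ℝ)
    (hA : BlochHomogenization.IsAdmissible A) :
    ∃ δ₀ : ℝ, 0 < δ₀ ∧
      -- on `B_{δ₀}(0)` the first eigenvalue is simple and its eigenfunction can be normalized
      (∀ ρ : ℝ, 0 < ρ → ∀ η : BlochHomogenization.Space d, ‖η‖ < δ₀ →
        ∃ φ : BlochHomogenization.Space d → ℂ,
          BlochHomogenization.IsNormalizedFirstBloch A ρ η φ ∧
          ∀ ψ : BlochHomogenization.Space d → ℂ,
            BlochHomogenization.IsFirstBlochEigenfunction A ρ η ψ →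
              ∃ c : ℂ, ψ =ᵐ[volume] fun y => c * φ y) ∧
      -- convergence, for every ball `U = B_δ(0)` on which normalized eigenfunctions are given
      ∀ (δ : ℝ), 0 < δ →
        ∀ φ : ℝ → BlochHomogenization.Space d → BlochHomogenization.Space d → ℂ,
        (∀ ρ : ℝ, 0 < ρ → ∀ η : BlochHomogenization.Space d, ‖η‖ < δ →
          BlochHomogenization.IsNormalizedFirstBloch A ρ η (φ ρ η)) →
        ∀ (ε κ : ℕ → ℝ), (∀ n, 0 < ε n) → (∀ n, 0 < κ n) → Tendsto ε atTop (𝓝 0) →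
        ∀ (K : Set (BlochHomogenization.Space d)), IsCompact K →
        ∀ (g : ℕ → BlochHomogenization.Space d → ℂ) (g₀ : BlochHomogenization.Space d → ℂ),
        (∀ n, MemLp (g n) 2 volume) → MemLp g₀ 2 volume →
        (∀ n, ∀ᵐ x, x ∉ K → g n x = 0) →
        BlochHomogenization.TendstoWeakL2 volume g g₀ →
        (δ ≤ δ₀ → ∀ n, BlochHomogenization.MemL2Loc
          (((ε n)⁻¹ • Metric.ball (0 : BlochHomogenization.Space d) δ).indicator
            (BlochHomogenization.blochTransform φ (κ n) (ε n) (g n)))) ∧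
        BlochHomogenization.TendstoWeakL2Loc
          (fun n => ((ε n)⁻¹ • Metric.ball (0 : BlochHomogenization.Space d) δ).indicator
            (BlochHomogenization.blochTransform φ (κ n) (ε n) (g n)))
          (BlochHomogenization.fourierTransform g₀) := by
  open BlochHomogenization in
  obtain ⟨α, hα0, hα⟩ := hA.elliptic
  obtain ⟨δ₀, hδ₀, hsmall⟩ := exists_isSmall hA hα0
  refine ⟨δ₀, hδ₀, fun ρ hρ η hη => exists_isNormalizedFirstBloch hα0 hα (hsmall η hη) hρ, ?_⟩
  intro δ hδ φ hφ ε κ hε hκ hε0 K hK g g₀ hg hg₀ hsupp hweak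
  obtain ⟨R, hR, hKR⟩ : ∃ R, 0 ≤ R ∧ K ⊆ Metric.closedBall (0 : Space d) R := by
    obtain ⟨R, hKR⟩ := hK.isBounded.subset_closedBall 0
    exact ⟨max R 0, le_max_right _ _,
      hKR.trans (Metric.closedBall_subset_closedBall (le_max_left _ _))⟩
  have hsuppR : ∀ n, ∀ᵐ x, x ∉ Metric.closedBall (0 : Space d) R → g n x = 0 := fun n => by
    filter_upwards [hsupp n] with x hx hxR
    exact hx fun h => hxR (hKR h)
  obtain ⟨C, hC, hgC⟩ := exists_eLpNorm_le_of_tendstoWeakL2 hg hweak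
  have hscaled : ∀ n ξ, ξ ∈ (ε n)⁻¹ • Metric.ball (0 : Space d) δ ↔ ‖ε n • ξ‖ < δ := fun n ξ => by
    rw [Set.mem_inv_smul_set_iff₀ (hε n).ne', mem_ball_zero_iff]
  constructor
  · intro hδδ₀ n Q hQ
    have hfin : IsFiniteMeasure ((volume : Measure (Space d)).restrict Q) :=
      ⟨by rw [Measure.restrict_apply_univ]; exact hQ.measure_lt_top⟩
    have hsmall' : ∀ η : Space d, ‖η‖ < δ → IsSmall hA α η :=
      fun η hη => hsmall η (hη.trans_le hδδ₀)
    have hset : (ε n)⁻¹ • Metric.ball (0 : Space d) δ = {ξ | ‖ε n • ξ‖ < δ} :=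
      Set.ext fun ξ => hscaled n ξ
    have hopen : IsOpen {ξ : Space d | ‖ε n • ξ‖ < δ} :=
      isOpen_lt (continuous_const_smul _).norm continuous_const
    have hB := fun ξ => norm_blochTransform_le hα0 hα hsmall' hφ (hg n) hR (hε n) (hκ n)
      (hsuppR n) hC (hgC n) (ξ := ξ)
    set B := C * (ballFactor d R (ε n) *
      (normConst d * Real.sqrt (16 * entryBound hA / α) * δ + normConst d))
    rw [hset]
    refine MemLp.of_bound (AEStronglyMeasurable.restrict ?_) |B| (Eventually.of_forall fun ξ => ?_)
    · exact (aestronglyMeasurable_indicator_iff hopen.measurableSet).mpr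
        ((continuousOn_blochTransform hα0 hα hsmall' hφ (hg n) hR (hε n) (hκ n)
          (hsuppR n)).aestronglyMeasurable hopen.measurableSet)
    · by_cases hξ : ‖ε n • ξ‖ < δ
      · rw [Set.indicator_of_mem (show ξ ∈ {ξ : Space d | ‖ε n • ξ‖ < δ} from hξ)]
        exact (hB ξ hξ).trans (le_abs_self B)
      · rw [Set.indicator_of_notMem (show ξ ∉ {ξ : Space d | ‖ε n • ξ‖ < δ} from hξ), norm_zero]
        exact abs_nonneg B
  · intro Q hQ
    have hfin : IsFiniteMeasure ((volume : Measure (Space d)).restrict Q) :=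
      ⟨by rw [Measure.restrict_apply_univ]; exact hQ.measure_lt_top⟩
    -- `δ` may exceed `δ₀`, but only quasimomenta below `r` matter: `ε_n Q` eventually lies in the
    -- ball of radius `r`, where the estimates hold and the indicator equals one.
    set r := min δ δ₀
    have hr : 0 < r := lt_min hδ hδ₀
    have hsmall' : ∀ η : Space d, ‖η‖ < r → IsSmall hA α η :=
      fun η hη => hsmall η (hη.trans_le (min_le_right _ _))
    have hφ' : ∀ ρ : ℝ, 0 < ρ → ∀ η : Space d, ‖η‖ < r →
        IsNormalizedFirstBloch A ρ η (φ ρ η) :=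
      fun ρ hρ η hη => hφ ρ hρ η (hη.trans_le (min_le_left _ _))
    have hQm : MeasurableSet Q := hQ.isClosed.measurableSet
    obtain ⟨S, hS⟩ := hQ.isBounded.exists_norm_le
    have hev : ∀ᶠ n in atTop, ε n ≤ 1 ∧ ∀ ξ ∈ Q, ‖ε n • ξ‖ < r := by
      have h1 : Tendsto (fun n => ε n * S) atTop (𝓝 0) := by simpa using hε0.mul_const S
      filter_upwards [h1.eventually_lt_const hr, hε0.eventually_le_const one_pos] with n hn1 hn2
      refine ⟨hn2, fun ξ hξ => ?_⟩
      rw [norm_smul, Real.norm_of_nonneg (hε n).le]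
      exact (mul_le_mul_of_nonneg_left (hS ξ hξ) (hε n).le).trans_lt hn1
    have heq : ∀ n ξ, ‖ε n • ξ‖ < r →
        ((ε n)⁻¹ • Metric.ball (0 : Space d) δ).indicator (blochTransform φ (κ n) (ε n) (g n)) ξ =
          blochTransform φ (κ n) (ε n) (g n) ξ := fun n ξ hξ =>
      Set.indicator_of_mem ((hscaled n ξ).mpr (hξ.trans_le (min_le_left _ _))) _
    have hc := normConst_pos (d := d)
    refine tendstoWeakL2_of_bounded (B := C * (ballFactor d R 1 *
      (normConst d * Real.sqrt (16 * entryBound hA / α) * r + normConst d))) ?_ ?_ ?_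
    · filter_upwards [hev] with n hn
      refine AEStronglyMeasurable.congr (f := blochTransform φ (κ n) (ε n) (g n)) ?_ ?_
      · exact ((continuousOn_blochTransform hα0 hα hsmall' hφ' (hg n) hR (hε n) (hκ n)
          (hsuppR n)).mono hn.2).aestronglyMeasurable hQm
      · filter_upwards [ae_restrict_mem hQm] with ξ hξ
        exact (heq n ξ (hn.2 ξ hξ)).symm
    · filter_upwards [hev] with n hn
      filter_upwards [ae_restrict_mem hQm] with ξ hξ
      rw [heq n ξ (hn.2 ξ hξ)]
      refine (norm_blochTransform_le hα0 hα hsmall' hφ' (hg n) hR (hε n) (hκ n)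
        (hsuppR n) hC (hgC n) (hn.2 ξ hξ)).trans ?_
      have := ballFactor_mono (d := d) hR (hε n) hn.1
      gcongr
    · filter_upwards [ae_restrict_mem hQm] with ξ hξ
      -- At fixed `ξ` the transform is the Fourier integral of `g_n`, which converges, plus an error
      -- of order `‖ε_n ξ‖`.
      have h1 : Tendsto (fun n => (normConst d : ℂ) * ∫ x, g n x * planeWave ξ x) atTop
          (𝓝 (fourierTransform g₀ ξ)) :=
        (tendsto_integral_planeWave hK hsupp hweak ξ).const_mul _
      have h2 : Tendsto (fun n => blochTransform φ (κ n) (ε n) (g n) ξ -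
          normConst d * ∫ x, g n x * planeWave ξ x) atTop (𝓝 0) := by
        have h3 : Tendsto (fun n => C * (ballFactor d R 1 *
            (normConst d * Real.sqrt (16 * entryBound hA / α) * ‖ε n • ξ‖))) atTop (𝓝 0) := by
          have h4 : Tendsto (fun n => ‖ε n • ξ‖) atTop (𝓝 0) := by
            simpa using (hε0.smul_const ξ).norm
          simpa using ((h4.const_mul (normConst d * Real.sqrt (16 * entryBound hA / α))).const_mul
            (ballFactor d R 1)).const_mul C
        refine squeeze_zero_norm' ?_ h3
        filter_upwards [hev] with n hn
        refine (norm_blochTransform_sub_le hα0 hα hsmall' hφ' (hg n) hR (hε n) (hκ n)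
          (hsuppR n) hC (hgC n) (hn.2 ξ hξ)).trans ?_
        have := ballFactor_mono (d := d) hR (hε n) hn.1
        gcongr
      have h3 := h2.add h1
      rw [zero_add] at h3
      refine h3.congr' ?_
      filter_upwards [hev] with n hn
      rw [heq n ξ (hn.2 ξ hξ), sub_add_cancel]
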